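/- Let $\alpha,\beta\ge 2$ and let $\kappa=\kappa(\alpha,\beta)$ be the complete bipartite graph on white vertices $u_1,\dots,u_\alpha$ and black vertices $v_1,\dots,v_\beta$. For each edge $u_iv_j$ of $\kappa$ take a solid square $A_{ij}$ whose four sides, read anticlockwise from a base vertex and all directed anticlockwise, are labelled $u_i^1, v_j^1, u_i^2, v_j^2$. The tile complex $TC(\kappa)$ is the quotient space of the disjoint union of the $\alpha\beta$ squares $A_{ij}$ obtained by gluing together all sides with the same label, respecting their directions. Then the integral homology groups of $TC(\kappa)$ are \[ H_n(TC(\kappa)) \cong \begin{cases} \mathbb{Z} & \text{for } n = 0,\\ \mathbb{Z}^{\alpha+\beta-2} & \text{for } n = 1,\\ \mathbb{Z}^{(\alpha-1)(\beta-1)} & \text{for } n = 2,\\ 0 & \text{for } n \ge 3, \end{cases} \] and the reduced homology group $\tilde H_0(TC(\kappa))$, that is, the kernel of the map $H_0(TC(\kappa))\to H_0(\mathrm{pt})$ induced by the map to a point, is $0$. -/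

import Mathlib

open scoped unitInterval

/-- A family, indexed by `ι`, of solid squares whose four sides are directed and carry labels
from `L`. The sides of a square are numbered `0, 1, 2, 3` anticlockwise, starting from the base
vertex; `forward a k` says that side `k` of square `a` is directed anticlockwise. -/
structure DirectedSquares (ι L : Type) where
  label : ι → Fin 4 → L
  forward : ι → Fin 4 → Bool

namespace DirectedSquares

/-- Anticlockwise parametrisation of the side `k` of the unit square `I × I`, whose base vertex
is `(0, 0)`: bottom, right, top, left. -/
def side (k : Fin 4) (s : I) : I × I :=
  match k with
  | 0 => (s, 0)
  | 1 => (1, s)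
  | 2 => (σ s, 1)
  | 3 => (0, σ s)

variable {ι L : Type} (S : DirectedSquares ι L)

/-- Parametrisation of the side `k` of square `a` along its direction. -/
def directedSide (a : ι) (k : Fin 4) (s : I) : I × I :=
  if S.forward a k then side k s else side k (σ s)

/-- Generators of the gluing: sides with the same label are identified pointwise,
respecting their directions. -/
inductive Glue : (Σ _ : ι, I × I) → (Σ _ : ι, I × I) → Prop
  | mk (a b : ι) (k l : Fin 4) (h : S.label a k = S.label b l) (s : I) :
      Glue ⟨a, S.directedSide a k s⟩ ⟨b, S.directedSide b l s⟩

/-- The 4-polyhedron of a family of directed labelled squares: the quotient space of the disjoint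
union of the squares by the equivalence relation generated by the gluing of like-labelled sides. -/
abbrev Polyhedron : Type := Quot S.Glue

end DirectedSquares

/-- The labels of the sides: `Sum.inl (p, r)` is $u_p^{r+1}$ and `Sum.inr (q, r)` is
$v_q^{r+1}$, for `r = 0, 1`. -/
abbrev TileLabel (α β : ℕ) : Type := (Fin α × Fin 2) ⊕ (Fin β × Fin 2)

/-- The tiles of a bipartite graph `G` with white vertices `Fin α` and black vertices `Fin β`:
for each edge $e = u_p v_q$ of `G` one square $A_e$, whose sides, all directed forward, are
labelled anticlockwise by $u_p^1, v_q^1, u_p^2, v_q^2$. -/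
def tiles {α β : ℕ} (G : SimpleGraph (Fin α ⊕ Fin β)) :
    DirectedSquares {e : Fin α × Fin β // G.Adj (Sum.inl e.1) (Sum.inr e.2)} (TileLabel α β) where
  label e := ![Sum.inl (e.1.1, 0), Sum.inr (e.1.2, 0), Sum.inl (e.1.1, 1), Sum.inr (e.1.2, 1)]
  forward _ _ := true

/-- The tile complex of a bipartite graph, as a topological space. -/
abbrev TC {α β : ℕ} (G : SimpleGraph (Fin α ⊕ Fin β)) : Type := (tiles G).Polyhedron

/-- Singular homology of a space with integer coefficients. -/
noncomputable abbrev integralHomology (n : ℕ) (X : Type) [TopologicalSpace X] : ModuleCat.{0} ℤ :=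
  ((AlgebraicTopology.singularHomologyFunctor (ModuleCat.{0} ℤ) n).obj (ModuleCat.of ℤ ℤ)).obj
    (TopCat.of X)

/-- Reduced integral homology of a (nonempty) space: the kernel of the map induced on singular
homology by the map to a one-point space. -/
noncomputable abbrev reducedHomology (n : ℕ) (X : Type) [TopologicalSpace X] :
    Submodule ℤ (integralHomology n X) :=
  LinearMap.ker
    (((AlgebraicTopology.singularHomologyFunctor (ModuleCat.{0} ℤ) n).obj
      (ModuleCat.of ℤ ℤ)).map
        (TopCat.ofHom (ContinuousMap.const X PUnit.unit : C(X, PUnit.{1})))).hom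

/-! The labels of the horizontal sides of the tile of $u_iv_j$ depend only on $i$, those of the
vertical sides only on $j$. Sending the point $(x,y)$ of this tile to (height $x$ on arc $i$, height
$y$ on arc $j$) therefore identifies the tile complex with $\Theta_\alpha\times\Theta_\beta$, where
$\Theta_k$ is the graph of two poles joined by $k$ arcs (`TileComplex.homeo`).

Removing one pole from $\Theta_{k+1}$ leaves a contractible open set, removing both leaves $k+1$
open arcs. In the Mayer–Vietoris sequence of the induced cover of $P\times\Theta_{k+1}$ both pieces
project to $P$ by homotopy equivalences, so the sequence splits: $H_{n+1}(P\times\Theta_{k+1})\cong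
H_{n+1}(P)\oplus\ker(H_n(P)^{k+1}\to H_n(P))\cong H_{n+1}(P)\oplus H_n(P)^k$
(`Theta.nonempty_homology_prod_equiv`). Taking for $P$ a point and then $\Theta_\alpha$ gives all
positive degrees; degree $0$ is path-connectedness.

Mayer–Vietoris is built from singular chains: barycentric subdivision shows that small simplices
compute homology (`homologyMap_smallIncl_bijective`), small chains of a two-set cover form a short
exact sequence (`shortExact_of_pullback`), and its long exact sequence is split by the projection
(`nonempty_homology_equiv_prod_ker`). -/

open CategoryTheory Limits AlgebraicTopology Opposite

/-! ### Singular chains as finitely supported functions -/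

section Bridge

open Simplicial

/-- The affine map of standard simplices induced by a map of their vertices. -/
noncomputable def simplexMap {n m : ℕ} (f : Fin (n + 1) → Fin (m + 1)) :
    C(stdSimplex ℝ (Fin (n + 1)), stdSimplex ℝ (Fin (m + 1))) :=
  ⟨stdSimplex.map f, stdSimplex.continuous_map f⟩

theorem simplexMap_id (n : ℕ) : simplexMap (id : Fin (n + 1) → Fin (n + 1)) = .id _ :=
  ContinuousMap.ext stdSimplex.map_id_apply

theorem simplexMap_comp {n m k : ℕ} (f : Fin (n + 1) → Fin (m + 1))
    (g : Fin (m + 1) → Fin (k + 1)) :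
    simplexMap (g ∘ f) = (simplexMap g).comp (simplexMap f) :=
  ContinuousMap.ext fun t => (stdSimplex.map_comp_apply f g t).symm

/-- The singular simplicial set of a space, with simplices the continuous maps from the standard
simplices. -/
noncomputable def singSetObj (X : Type) [TopologicalSpace X] : SSet.{0} where
  obj n := C(stdSimplex ℝ (Fin (n.unop.len + 1)), X)
  map f := ↾ fun ς => ς.comp (simplexMap f.unop)
  map_id _ := ConcreteCategory.hom_ext _ _ fun ς =>
    congrArg (ContinuousMap.comp ς) (simplexMap_id _)
  map_comp f g := ConcreteCategory.hom_ext _ _ fun ς =>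
    congrArg (ContinuousMap.comp ς) (simplexMap_comp g.unop f.unop)

/-- The map of singular simplicial sets induced by a continuous map. -/
noncomputable def singSetMap {X Y : Type} [TopologicalSpace X] [TopologicalSpace Y] (g : C(X, Y)) :
   singSetObj X ⟶ singSetObj Y where
  app n := ↾ fun ς : C(stdSimplex ℝ (Fin (n.unop.len + 1)), X) => g.comp ς

/-- The singular simplicial set functor. -/
noncomputable def singSet : TopCat.{0} ⥤ SSet.{0} where
  obj X := singSetObj X
  map g := singSetMap g.hom

/-- The chain complex of a simplicial set, with chains finitely supported functions. -/
noncomputable def freeChains : SSet.{0} ⥤ ChainComplex (ModuleCat.{0} ℤ) ℕ :=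
  (SimplicialObject.whiskering _ _).obj (ModuleCat.free ℤ) ⋙ alternatingFaceMapComplex _

/-- The inclusion of the summand of the free module at an index. -/
noncomputable def freeIncl {J : Type} (j : J) : ModuleCat.of ℤ ℤ ⟶ (ModuleCat.free ℤ).obj J :=
  ModuleCat.ofHom (Finsupp.lsingle j)

/-- Copowers of `ℤ` are free modules. -/
noncomputable def sigmaConstIso : sigmaConst.obj (ModuleCat.of ℤ ℤ) ≅ ModuleCat.free.{0} ℤ :=
  NatIso.ofComponents (fun J =>
    { hom := Sigma.desc (fun j => freeIncl j)
      inv := ModuleCat.freeDesc (↾ fun j => (Sigma.ι (fun _ : J => ModuleCat.of ℤ ℤ) j) 1)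
      hom_inv_id := by
        refine Limits.Sigma.hom_ext _ _ fun j => ?_
        erw [Sigma.ι_desc_assoc, Category.comp_id]
        ext
        exact ModuleCat.freeDesc_apply _ _
      inv_hom_id := by
        ext j
        rw [ConcreteCategory.comp_apply, ModuleCat.freeDesc_apply]
        exact congr($(Sigma.ι_desc (fun j => freeIncl j) j).hom 1) }) (by
    intro J J' f
    refine Limits.Sigma.hom_ext _ _ fun j => ?_
    dsimp only [sigmaConst]
    erw [Sigma.ι_comp_map'_assoc, Category.id_comp, Sigma.ι_desc, Sigma.ι_desc_assoc]
    ext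
    exact (ModuleCat.free_map_apply _ _).symm)

/-- The comparison of `singSet` with the singular simplicial set functor of Mathlib. -/
noncomputable def singSetIso : TopCat.toSSet ≅ singSet :=
  NatIso.ofComponents (fun X => NatIso.ofComponents
    (fun n => Equiv.toIso (Y := (singSetObj X).obj n) (X.toSSetObjEquiv n))
    (by intro n m f; rfl)) (by intro X Y f; rfl)

/-- The comparison of singular chain complexes with finitely supported chains. -/
noncomputable def chainIso :
    (singularChainComplexFunctor (ModuleCat.{0} ℤ)).obj (ModuleCat.of ℤ ℤ) ≅
      singSet ⋙ freeChains :=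
  Functor.isoWhiskerLeft TopCat.toSSet
      (Functor.isoWhiskerRight ((SimplicialObject.whiskering _ _).mapIso sigmaConstIso)
        (alternatingFaceMapComplex _)) ≪≫
    Functor.isoWhiskerRight singSetIso freeChains

/-- The boundary of chains on a simplicial set. -/
noncomputable def bdry (K : SSet.{0}) (n : ℕ) : (K _⦋n+1⦌ →₀ ℤ) →ₗ[ℤ] (K _⦋n⦌ →₀ ℤ) :=
  ∑ i : Fin (n + 2), (-1 : ℤ) ^ (i : ℕ) • Finsupp.lmapDomain ℤ ℤ (K.δ i)

theorem freeChains_d (K : SSet.{0}) (n : ℕ) :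
    (freeChains.obj K).d (n+1) n = ModuleCat.ofHom (bdry K n) := by
  refine (alternatingFaceMapComplex_obj_d _ _).trans ?_
  rw [AlternatingFaceMapComplex.objD, bdry]
  apply ModuleCat.hom_ext
  rw [ModuleCat.hom_sum]
  exact Finset.sum_congr rfl fun i _ => rfl

theorem bdry_single (K : SSet.{0}) (n : ℕ) (x : K _⦋n+1⦌) (r : ℤ) :
    bdry K n (Finsupp.single x r) =
      ∑ i : Fin (n + 2), (-1 : ℤ) ^ (i : ℕ) • Finsupp.single (K.δ i x) r := by
  simp [bdry, LinearMap.sum_apply]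

theorem bdry_bdry (K : SSet.{0}) (n : ℕ) (x : K _⦋n+2⦌ →₀ ℤ) : bdry K n (bdry K (n+1) x) = 0 := by
  have := (freeChains.obj K).d_comp_d (n+2) (n+1) n
  rw [freeChains_d, freeChains_d] at this
  exact congr($(this).hom x)

theorem bdry_map {K L : SSet.{0}} (f : K ⟶ L) (n : ℕ) (x : K _⦋n+1⦌ →₀ ℤ) :
    bdry L n (Finsupp.lmapDomain ℤ ℤ (f.app (op ⦋n+1⦌)) x) =
      Finsupp.lmapDomain ℤ ℤ (f.app (op ⦋n⦌)) (bdry K n x) := by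
  have := (freeChains.map f).comm (n+1) n
  rw [freeChains_d, freeChains_d] at this
  exact congr($(this).hom x)

end Bridge

/-! ### Affine simplices, chains on vertex tuples, cones -/

/-- The standard topological simplex of dimension `n`. -/
abbrev Simplex (n : ℕ) : Type := stdSimplex ℝ (Fin (n + 1))

/-- The affine map between standard simplices with given values at the vertices. -/
noncomputable def aff {n m : ℕ} (w : Fin (n + 1) → Simplex m) : C(Simplex n, Simplex m) where
  toFun t := ⟨∑ i, t.1 i • (w i).1, (convex_stdSimplex ℝ _).sum_mem (fun i _ => t.2.1 i) t.2.2
    (fun i _ => (w i).2)⟩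
  continuous_toFun := by
    refine Continuous.subtype_mk ?_ _
    refine continuous_finsetSum _ fun i _ => ?_
    exact ((continuous_apply i).comp continuous_subtype_val).smul continuous_const

theorem aff_val {n m : ℕ} (w : Fin (n + 1) → Simplex m) (t : Simplex n) :
    (aff w t).1 = ∑ i, t.1 i • (w i).1 := rfl

theorem aff_comp {n m k : ℕ} (v : Fin (m + 1) → Simplex k) (w : Fin (n + 1) → Simplex m) :
    aff (aff v ∘ w) = (aff v).comp (aff w) := by
  ext t : 1
  apply Subtype.ext
  simp only [ContinuousMap.comp_apply, aff_val, Function.comp_apply, Finset.sum_apply,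
    Pi.smul_apply, Finset.smul_sum, Finset.sum_smul, smul_assoc]
  exact Finset.sum_comm

theorem aff_comp_simplexMap {n m k : ℕ} (f : Fin (n + 1) → Fin (m + 1))
    (w : Fin (m + 1) → Simplex k) : (aff w).comp (simplexMap f) = aff (w ∘ f) := by
  ext t : 1
  apply Subtype.ext
  have h (j) : (simplexMap f t).1 j = ∑ i with f i = j, t.1 i := by
    change FunOnFinite.linearMap ℝ ℝ f t.1 j = _
    rw [FunOnFinite.linearMap_apply_apply]
  simp only [ContinuousMap.comp_apply, aff_val, h, Finset.sum_smul, Function.comp_apply]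
  rw [← Finset.sum_fiberwise (s := Finset.univ) (g := f)]
  refine Finset.sum_congr rfl fun j _ => Finset.sum_congr rfl fun i hi => ?_
  rw [(Finset.mem_filter.1 hi).2]

/-- The tuple of vertices of the standard simplex. -/
noncomputable def vertices (n : ℕ) : Fin (n + 1) → Simplex n := fun i => stdSimplex.vertex i

theorem aff_vertices (n : ℕ) : aff (vertices n) = .id (Simplex n) := by
  ext t : 1
  apply Subtype.ext
  ext j
  simp [aff_val, vertices, stdSimplex.vertex, Pi.single_apply]

theorem aff_comp_vertices {n m : ℕ} (w : Fin (n + 1) → Simplex m) : aff w ∘ vertices n = w := by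
  ext i : 1
  apply Subtype.ext
  simp [aff_val, vertices, stdSimplex.vertex, Pi.single_apply]

theorem aff_val_mem_convexHull {n m : ℕ} (w : Fin (n + 1) → Simplex m) (t : Simplex n) :
   (aff w t).1 ∈ convexHull ℝ (Set.range fun i => (w i).1) := by
  rw [aff_val]
  exact (convex_convexHull ℝ _).sum_mem (fun i _ => t.2.1 i) t.2.2
    fun i _ => subset_convexHull ℝ _ ⟨i, rfl⟩

/-- The simplicial set whose `n`-simplices are the `(n + 1)`-tuples of elements of `E`. -/
def tuples (E : Type) : SSet.{0} where
  obj n := Fin (n.unop.len + 1) → E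
  map f := ↾ fun w => w ∘ f.unop

/-- The map of simplicial sets applying a function to all entries of tuples. -/
def tuplesMap {E E' : Type} (f : E → E') : tuples E ⟶ tuples E' where
  app n := ↾ fun w : Fin (n.unop.len + 1) → E => f ∘ w

/-- The affine simplices of a singular simplex. -/
noncomputable def realize {X : Type} [TopologicalSpace X] {m : ℕ} (ς : C(Simplex m, X)) :
    tuples (Simplex m) ⟶ singSetObj X where
  app n := ↾ fun w : Fin (n.unop.len + 1) → Simplex m => ς.comp (aff w)
  naturality _ _ f := ConcreteCategory.hom_ext _ _ fun w =>
    congrArg (ContinuousMap.comp ς) (aff_comp_simplexMap f.unop w).symm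

/-- The chains on tuples of elements of `E`. -/
abbrev Tup (E : Type) (n : ℕ) : Type := (Fin (n+1) → E) →₀ ℤ

/-- The boundary of chains on tuples. -/
noncomputable def tbd (E : Type) (n : ℕ) : Tup E (n+1) →ₗ[ℤ] Tup E n := bdry (tuples E) n

theorem tbd_single {E : Type} (n : ℕ) (w : Fin (n+2) → E) (r : ℤ):
    tbd E n (Finsupp.single w r) =
      ∑ i : Fin (n + 2), (-1 : ℤ) ^ (i : ℕ) • Finsupp.single (w ∘ Fin.succAbove i) r :=
  bdry_single _ _ _ _

theorem tbd_tbd {E : Type} (n : ℕ) (x : Tup E (n+2)) : tbd E n (tbd E (n+1) x) = 0 :=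
  bdry_bdry _ _ _

/-- The cone with apex `b`. -/
noncomputable def cone {E : Type} (b : E) (n : ℕ) : Tup E n →ₗ[ℤ] Tup E (n+1) :=
  Finsupp.lmapDomain ℤ ℤ (fun w => (Fin.cons b w : Fin (n+2) → E))

theorem cone_single {E : Type} (b : E) (n : ℕ) (w : Fin (n+1) → E) (r : ℤ) :
   cone b n (Finsupp.single w r) = Finsupp.single (Fin.cons b w : Fin (n+2) → E) r := by
  simp [cone]

theorem cons_comp_succAbove_succ {E : Type} (b : E) {n : ℕ} (w : Fin (n+2) → E) (i : Fin (n+2)) :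
  (Fin.cons b w : Fin (n+3) → E) ∘ i.succ.succAbove = Fin.cons b (w ∘ i.succAbove) := by
  ext j
  cases j using Fin.cases <;> simp

/-- The face opposite the apex is the base; every other face is the cone on a face of the base, with
the sign shifted by one. -/
theorem tbd_cone {E : Type} (b : E) (n : ℕ) (x : Tup E (n+1)) :
   tbd E (n+1) (cone b (n+1) x) = x - cone b n (tbd E n x) := by
  induction x using Finsupp.induction_linear with
  | zero => simp
  | add x y hx hy => simp only [map_add, hx, hy]; abel
  | single w r =>
    rw [cone_single, tbd_single, tbd_single, Fin.sum_univ_succ, map_sum]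
    simp only [map_smul, cone_single, cons_comp_succAbove_succ]
    simp [pow_succ, Function.comp_def, sub_eq_add_neg]

/-- In degree zero the cone on the (empty) boundary is replaced by the apex, counted with the
augmentation of `x`. `sum_tbd` makes this term vanish on boundaries. -/
theorem tbd_cone_zero {E : Type} (b : E) (x : Tup E 0) :
   tbd E 0 (cone b 0 x) = x - Finsupp.single (fun _ => b) (x.sum fun _ r => r) := by
  induction x using Finsupp.induction_linear with
  | zero => simp
  | add x y hx hy =>
    rw [Finsupp.sum_add_index' (fun _ => rfl) (fun _ _ _ => rfl), Finsupp.single_add]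
    simp only [map_add, hx, hy]; abel
  | single w r =>
    have h₀ : (Fin.cons b w : Fin 2 → E) ∘ Fin.succAbove 0 = w := by
      ext j; fin_cases j; rfl
    have h₁ : (Fin.cons b w : Fin 2 → E) ∘ Fin.succAbove 1 = fun _ => b := by
      ext j; fin_cases j; rfl
    rw [cone_single, tbd_single, Fin.sum_univ_two, h₀, h₁, Finsupp.sum_single_index rfl]
    simp only [Fin.val_zero, Fin.val_one, pow_zero, pow_one, one_smul, neg_smul, sub_eq_add_neg]

theorem sum_tbd {E : Type} (x : Tup E 1) : (tbd E 0 x).sum (fun _ r => r) = 0 := by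
  induction x using Finsupp.induction_linear with
  | zero => simp
  | add x y hx hy =>
    rw [map_add, Finsupp.sum_add_index' (fun _ => rfl) (fun _ _ _ => rfl), hx, hy, add_zero]
  | single w r =>
    rw [tbd_single, Fin.sum_univ_two]
    simp [Finsupp.sum_add_index', ← Finsupp.single_neg]

/-! ### Barycentric subdivision of affine chains -/

/-- The barycenter of a tuple. -/
noncomputable def bary {n m : ℕ} (w : Fin (n + 1) → Simplex m) : Simplex m :=
  aff w stdSimplex.barycenter

/-- The barycentric subdivision. -/
noncomputable def subdiv (m : ℕ) : ∀ n, Tup (Simplex m) n →ₗ[ℤ] Tup (Simplex m) n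
  | 0 => LinearMap.id
  | n + 1 => Finsupp.linearCombination ℤ fun w =>
      cone (bary w) n (subdiv m n (tbd _ n (Finsupp.single w 1)))

/-- The chain homotopy from the barycentric subdivision to the identity. -/
noncomputable def subdivHtpy (m : ℕ) : ∀ n, Tup (Simplex m) n →ₗ[ℤ] Tup (Simplex m) (n + 1)
  | 0 => 0
  | n + 1 => Finsupp.linearCombination ℤ fun w =>
      cone (bary w) (n + 1) (Finsupp.single w 1 - subdivHtpy m n (tbd _ n (Finsupp.single w 1)))

theorem subdiv_succ_single (m n : ℕ) (w : Fin (n + 2) → Simplex m) :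
    subdiv m (n + 1) (Finsupp.single w 1) =
      cone (bary w) n (subdiv m n (tbd _ n (Finsupp.single w 1))) := by
  simp [subdiv]

theorem subdivHtpy_succ_single (m n : ℕ) (w : Fin (n + 2) → Simplex m) :
    subdivHtpy m (n + 1) (Finsupp.single w 1) =
      cone (bary w) (n + 1)
        (Finsupp.single w 1 - subdivHtpy m n (tbd _ n (Finsupp.single w 1))) := by
  simp [subdivHtpy]

/-- By the cone formula, the boundary of the subdivided simplex is its subdivided boundary minus a
cone on the boundary of the latter; by induction that correction is a cone on the subdivision of a
double boundary, hence zero. -/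
theorem tbd_subdiv (m n : ℕ) (x : Tup (Simplex m) (n + 1)) :
    tbd _ n (subdiv m (n + 1) x) = subdiv m n (tbd _ n x) := by
  induction n with
  | zero =>
    suffices h : tbd _ 0 ∘ₗ subdiv m 1 = subdiv m 0 ∘ₗ tbd _ 0 from congr($h x)
    refine Finsupp.lhom_ext' fun w => LinearMap.ext_ring ?_
    simp only [LinearMap.comp_apply, Finsupp.lsingle_apply]
    rw [subdiv_succ_single, tbd_cone_zero]
    simp [subdiv, sum_tbd]
  | succ n ih =>
    suffices h : tbd _ (n + 1) ∘ₗ subdiv m (n + 2) = subdiv m (n + 1) ∘ₗ tbd _ (n + 1) from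
      congr($h x)
    refine Finsupp.lhom_ext' fun w => LinearMap.ext_ring ?_
    simp only [LinearMap.comp_apply, Finsupp.lsingle_apply]
    rw [subdiv_succ_single, tbd_cone, ih, tbd_tbd, map_zero, map_zero, sub_zero]

theorem tbd_subdivHtpy (m n : ℕ) (x : Tup (Simplex m) (n + 1)) :
    tbd _ (n + 1) (subdivHtpy m (n + 1) x) + subdivHtpy m n (tbd _ n x) =
      x - subdiv m (n + 1) x := by
  induction n with
  | zero =>
    suffices h : tbd _ 1 ∘ₗ subdivHtpy m 1 + subdivHtpy m 0 ∘ₗ tbd _ 0 =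
        LinearMap.id - subdiv m 1 from congr($h x)
    refine Finsupp.lhom_ext' fun w => LinearMap.ext_ring ?_
    simp only [LinearMap.comp_apply, Finsupp.lsingle_apply, LinearMap.add_apply,
      LinearMap.sub_apply, LinearMap.id_apply]
    rw [subdivHtpy_succ_single, tbd_cone, subdiv_succ_single]
    simp [subdivHtpy, subdiv]
  | succ n ih =>
    suffices h : tbd _ (n + 2) ∘ₗ subdivHtpy m (n + 2) + subdivHtpy m (n + 1) ∘ₗ tbd _ (n + 1) =
        LinearMap.id - subdiv m (n + 2) from congr($h x)
    refine Finsupp.lhom_ext' fun w => LinearMap.ext_ring ?_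
    simp only [LinearMap.comp_apply, Finsupp.lsingle_apply, LinearMap.add_apply,
      LinearMap.sub_apply, LinearMap.id_apply]
    -- Writing $T$ for the homotopy and $S$ for subdivision, induction gives $\partial T\partial
    -- w=\partial w-S\partial w$. So $w-T\partial w$ has boundary $S\partial w$, whose cone is $Sw$.
    have h := ih (tbd _ (n + 1) (Finsupp.single w 1))
    rw [tbd_tbd, map_zero, add_zero] at h
    rw [subdivHtpy_succ_single, tbd_cone, subdiv_succ_single, map_sub, h]
    simp only [sub_sub_cancel]
    abel

/-- The map on chains of tuples induced by an affine map. -/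
noncomputable def pushTup {m k : ℕ} (v : Fin (m + 1) → Simplex k) (n : ℕ) :
    Tup (Simplex m) n →ₗ[ℤ] Tup (Simplex k) n :=
  Finsupp.lmapDomain ℤ ℤ fun w => aff v ∘ w

theorem pushTup_single {m k n : ℕ} (v : Fin (m + 1) → Simplex k) (w : Fin (n + 1) → Simplex m)
    (r : ℤ) : pushTup v n (Finsupp.single w r) = Finsupp.single (aff v ∘ w) r := by
  simp [pushTup]

theorem tbd_pushTup {m k : ℕ} (v : Fin (m + 1) → Simplex k) (n : ℕ) (x : Tup (Simplex m) (n + 1)) :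
    tbd _ n (pushTup v (n + 1) x) = pushTup v n (tbd _ n x) :=
  bdry_map (tuplesMap (aff v)) n x

theorem pushTup_cone {m k : ℕ} (v : Fin (m + 1) → Simplex k) (b : Simplex m) (n : ℕ)
    (x : Tup (Simplex m) n) :
    pushTup v (n + 1) (cone b n x) = cone (aff v b) n (pushTup v n x) := by
  simp only [pushTup, cone, Finsupp.lmapDomain_apply, ← Finsupp.mapDomain_comp]
  congr 1
  ext w i : 2
  cases i using Fin.cases <;> rfl

theorem bary_comp {m k n : ℕ} (v : Fin (m + 1) → Simplex k) (w : Fin (n + 1) → Simplex m) :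
    bary (aff v ∘ w) = aff v (bary w) := by
  rw [bary, aff_comp]; rfl

/-- Affine maps preserve barycenters and cones. This naturality lets subdivision be defined on
singular simplices through the identity simplex alone. -/
theorem pushTup_subdiv {m k : ℕ} (v : Fin (m + 1) → Simplex k) (n : ℕ) (x : Tup (Simplex m) n) :
    pushTup v n (subdiv m n x) = subdiv k n (pushTup v n x) := by
  induction n with
  | zero => rfl
  | succ n ih =>
    suffices h : pushTup v (n + 1) ∘ₗ subdiv m (n + 1) = subdiv k (n + 1) ∘ₗ pushTup v (n + 1) from
      congr($h x)
    refine Finsupp.lhom_ext' fun w => LinearMap.ext_ring ?_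
    simp only [LinearMap.comp_apply, Finsupp.lsingle_apply]
    rw [subdiv_succ_single, pushTup_cone, ih, ← tbd_pushTup, pushTup_single, subdiv_succ_single,
      bary_comp]

theorem pushTup_subdivHtpy {m k : ℕ} (v : Fin (m + 1) → Simplex k) (n : ℕ)
    (x : Tup (Simplex m) n) :
    pushTup v (n + 1) (subdivHtpy m n x) = subdivHtpy k n (pushTup v n x) := by
  induction n with
  | zero => simp [subdivHtpy]
  | succ n ih =>
    suffices h : pushTup v (n + 2) ∘ₗ subdivHtpy m (n + 1) =
        subdivHtpy k (n + 1) ∘ₗ pushTup v (n + 1) from congr($h x)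
    refine Finsupp.lhom_ext' fun w => LinearMap.ext_ring ?_
    simp only [LinearMap.comp_apply, Finsupp.lsingle_apply]
    rw [subdivHtpy_succ_single, pushTup_cone, map_sub, ih, ← tbd_pushTup, pushTup_single,
      subdivHtpy_succ_single, bary_comp]

/-! ### Barycentric subdivision of singular chains -/

/-- Singular chains of a space. -/
abbrev SChain (X : Type) [TopologicalSpace X] (n : ℕ) : Type := C(Simplex n, X) →₀ ℤ

section SingularSubdivision

variable {X : Type} [TopologicalSpace X]

/-- The boundary of singular chains. -/
noncomputable def sbd (X : Type) [TopologicalSpace X] (n : ℕ) :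
    SChain X (n + 1) →ₗ[ℤ] SChain X n := bdry (singSetObj X) n

theorem sbd_single (n : ℕ) (ς : C(Simplex (n + 1), X)) (r : ℤ) :
    sbd X n (Finsupp.single ς r) = ∑ i : Fin (n + 2), (-1 : ℤ) ^ (i : ℕ) •
      Finsupp.single (ς.comp (simplexMap i.succAbove)) r :=
  bdry_single _ _ _ _

theorem sbd_sbd (n : ℕ) (x : SChain X (n + 2)) : sbd X n (sbd X (n + 1) x) = 0 := bdry_bdry _ _ _

/-- The singular chain of a singular simplex `ς` given by a chain of affine simplices. -/
noncomputable def realChain {m : ℕ} (ς : C(Simplex m, X)) (n : ℕ) :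
    Tup (Simplex m) n →ₗ[ℤ] SChain X n :=
  Finsupp.lmapDomain ℤ ℤ fun w => ς.comp (aff w)

theorem realChain_single {m n : ℕ} (ς : C(Simplex m, X)) (w : Fin (n + 1) → Simplex m) (r : ℤ) :
    realChain ς n (Finsupp.single w r) = Finsupp.single (ς.comp (aff w)) r := by
  simp [realChain]

theorem realChain_vertices {n : ℕ} (ς : C(Simplex n, X)) (r : ℤ) :
    realChain ς n (Finsupp.single (vertices n) r) = Finsupp.single ς r := by
  rw [realChain_single, aff_vertices, ContinuousMap.comp_id]

theorem sbd_realChain {m : ℕ} (ς : C(Simplex m, X)) (n : ℕ) (x : Tup (Simplex m) (n + 1)) :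
    sbd X n (realChain ς (n + 1) x) = realChain ς n (tbd _ n x) :=
  bdry_map (realize ς) n x

theorem realChain_pushTup {m k : ℕ} (ς : C(Simplex k, X)) (v : Fin (m + 1) → Simplex k) (n : ℕ)
    (x : Tup (Simplex m) n) :
    realChain ς n (pushTup v n x) = realChain (ς.comp (aff v)) n x := by
  simp only [realChain, pushTup, Finsupp.lmapDomain_apply, ← Finsupp.mapDomain_comp]
  congr 1
  ext w : 1
  simp only [Function.comp_apply, aff_comp, ContinuousMap.comp_assoc]

/-- The barycentric subdivision of singular chains. -/
noncomputable def sd (X : Type) [TopologicalSpace X] (n : ℕ) : SChain X n →ₗ[ℤ] SChain X n :=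
  Finsupp.linearCombination ℤ fun ς =>
    realChain ς n (subdiv n n (Finsupp.single (vertices n) 1))

/-- The chain homotopy from the barycentric subdivision of singular chains to the identity. -/
noncomputable def sdHtpy (X : Type) [TopologicalSpace X] (n : ℕ) :
    SChain X n →ₗ[ℤ] SChain X (n + 1) :=
  Finsupp.linearCombination ℤ fun ς =>
    realChain ς (n + 1) (subdivHtpy n n (Finsupp.single (vertices n) 1))

theorem sd_single {n : ℕ} (ς : C(Simplex n, X)) :
    sd X n (Finsupp.single ς 1) = realChain ς n (subdiv n n (Finsupp.single (vertices n) 1)) := by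
  simp [sd]

theorem sdHtpy_single {n : ℕ} (ς : C(Simplex n, X)) :
    sdHtpy X n (Finsupp.single ς 1) =
      realChain ς (n + 1) (subdivHtpy n n (Finsupp.single (vertices n) 1)) := by
  simp [sdHtpy]

/-- Every affine simplex is the image of the tuple of vertices under an affine map, so naturality
reduces the claim to the definition of `sd`. -/
theorem sd_realChain {m : ℕ} (ς : C(Simplex m, X)) (n : ℕ) (x : Tup (Simplex m) n) :
    sd X n (realChain ς n x) = realChain ς n (subdiv m n x) := by
  suffices h : sd X n ∘ₗ realChain ς n = realChain ς n ∘ₗ subdiv m n from congr($h x)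
  refine Finsupp.lhom_ext' fun w => LinearMap.ext_ring ?_
  simp only [LinearMap.comp_apply, Finsupp.lsingle_apply]
  rw [realChain_single, sd_single, ← realChain_pushTup, pushTup_subdiv, pushTup_single,
    aff_comp_vertices]

theorem sdHtpy_realChain {m : ℕ} (ς : C(Simplex m, X)) (n : ℕ) (x : Tup (Simplex m) n) :
    sdHtpy X n (realChain ς n x) = realChain ς (n + 1) (subdivHtpy m n x) := by
  suffices h : sdHtpy X n ∘ₗ realChain ς n = realChain ς (n + 1) ∘ₗ subdivHtpy m n from
    congr($h x)
  refine Finsupp.lhom_ext' fun w => LinearMap.ext_ring ?_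
  simp only [LinearMap.comp_apply, Finsupp.lsingle_apply]
  rw [realChain_single, sdHtpy_single, ← realChain_pushTup, pushTup_subdivHtpy, pushTup_single,
    aff_comp_vertices]

/-- A singular simplex is the realization of the tuple of vertices, so the identity is the image of
`tbd_subdiv`; `sbd_sdHtpy` follows from `tbd_subdivHtpy` in the same way. -/
theorem sbd_sd (n : ℕ) (x : SChain X (n + 1)) : sbd X n (sd X (n + 1) x) = sd X n (sbd X n x) := by
  suffices h : sbd X n ∘ₗ sd X (n + 1) = sd X n ∘ₗ sbd X n from congr($h x)
  refine Finsupp.lhom_ext' fun ς => LinearMap.ext_ring ?_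
  simp only [LinearMap.comp_apply, Finsupp.lsingle_apply]
  rw [sd_single, sbd_realChain, tbd_subdiv, ← sd_realChain, ← sbd_realChain, realChain_vertices]

theorem sbd_sdHtpy (n : ℕ) (x : SChain X (n + 1)) :
    sbd X (n + 1) (sdHtpy X (n + 1) x) + sdHtpy X n (sbd X n x) = x - sd X (n + 1) x := by
  suffices h : sbd X (n + 1) ∘ₗ sdHtpy X (n + 1) + sdHtpy X n ∘ₗ sbd X n =
      LinearMap.id - sd X (n + 1) from congr($h x)
  refine Finsupp.lhom_ext' fun ς => LinearMap.ext_ring ?_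
  simp only [LinearMap.comp_apply, Finsupp.lsingle_apply, LinearMap.add_apply,
    LinearMap.sub_apply, LinearMap.id_apply]
  rw [sd_single, sdHtpy_single, sbd_realChain, ← realChain_vertices ς 1, sbd_realChain,
    sdHtpy_realChain, ← map_add, ← map_sub, tbd_subdivHtpy]

end SingularSubdivision

/-! ### Subdivision shrinks diameters -/

section Mesh

/-- The difference of $w_i$ and the barycenter is the average of the $n+1$ vectors $w_i-w_j$. The
one with $j=i$ vanishes and the others have norm at most $d$, whence the factor $n/(n+1)$; balls are
convex. -/
theorem convexHull_subset_closedBall_bary {m n : ℕ} (w : Fin (n + 1) → Simplex m) {d : ℝ}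
    (hw : ∀ i j, dist (w i) (w j) ≤ d) :
    convexHull ℝ (Set.range fun i => (w i).1) ⊆
      Metric.closedBall (bary w).1 (n / (n + 1) * d) := by
  refine convexHull_min ?_ (convex_closedBall _ _)
  rintro x ⟨i, hx⟩
  have hb : (bary w).1 = ∑ j, ((n : ℝ) + 1)⁻¹ • (w j).1 := by
    simp [bary, aff_val, stdSimplex.barycenter]
  have hi : (w i).1 = ∑ _j : Fin (n + 1), ((n : ℝ) + 1)⁻¹ • (w i).1 := by
    rw [Finset.sum_const, ← Nat.cast_smul_eq_nsmul ℝ, smul_smul, Finset.card_univ, Fintype.card_fin,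
      Nat.cast_add, Nat.cast_one, mul_inv_cancel₀ (by positivity), one_smul]
  rw [Metric.mem_closedBall, dist_eq_norm, hb, ← hx]
  beta_reduce
  rw [hi]
  rw [← Finset.sum_sub_distrib]
  refine (norm_sum_le _ _).trans ?_
  rw [← Finset.add_sum_erase _ _ (Finset.mem_univ i), sub_self, norm_zero, zero_add]
  refine (Finset.sum_le_card_nsmul _ _ (((n : ℝ) + 1)⁻¹ * d) fun j _ => ?_).trans_eq ?_
  · rw [← smul_sub, norm_smul, ← dist_eq_norm, Real.norm_of_nonneg (by positivity)]
    exact mul_le_mul_of_nonneg_left (hw i j) (by positivity)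
  · rw [Finset.card_erase_of_mem (Finset.mem_univ i), Finset.card_univ, Fintype.card_fin,
      nsmul_eq_mul, Nat.add_sub_cancel]
    ring

/-- The convex hull condition is carried through the induction because it bounds the distances from
the new apex, the barycenter; the remaining distances come from faces. -/
theorem subdiv_single_mem {m n : ℕ} (w : Fin (n + 1) → Simplex m) {d : ℝ}
    (hw : ∀ i j, dist (w i) (w j) ≤ d) :
    subdiv m n (Finsupp.single w 1) ∈ Finsupp.supported ℤ ℤ
      {v : Fin (n + 1) → Simplex m | (∀ i j, dist (v i) (v j) ≤ n / (n + 1) * d) ∧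
        ∀ i, (v i).1 ∈ convexHull ℝ (Set.range fun i => (w i).1)} := by
  induction n with
  | zero =>
    refine Finsupp.single_mem_supported _ _ ⟨fun i j => ?_, fun i => ?_⟩
    · rw [Subsingleton.elim (α := Fin 1) i j]; simp
    · exact subset_convexHull ℝ _ ⟨i, rfl⟩
  | succ n ih =>
    have hd : 0 ≤ d := dist_nonneg.trans (hw 0 0)
    -- The contraction factor increases with the dimension, so the bound for faces suffices.
    have hle : (n : ℝ) / (n + 1) * d ≤ ((n + 1 : ℕ) : ℝ) / ((n + 1 : ℕ) + 1) * d := by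
      refine mul_le_mul_of_nonneg_right ?_ hd
      rw [div_le_div_iff₀ (by positivity) (by positivity)]
      push_cast
      nlinarith
    have key : subdiv m n (tbd _ n (Finsupp.single w 1)) ∈ Finsupp.supported ℤ ℤ
      {v : Fin (n + 1) → Simplex m | (∀ i j, dist (v i) (v j) ≤ n / (n + 1) * d) ∧
        ∀ i, (v i).1 ∈ convexHull ℝ (Set.range fun i => (w i).1)} := by
      rw [tbd_single, map_sum]
      refine Submodule.sum_mem _ fun i _ => ?_
      rw [map_smul]
      refine Submodule.smul_mem _ _ (Finsupp.supported_mono ?_ (ih _ fun j k => hw _ _))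
      refine fun v hv => ⟨hv.1, fun j => convexHull_mono ?_ (hv.2 j)⟩
      exact Set.range_comp_subset_range i.succAbove fun i => (w i).1
    rw [subdiv_succ_single]
    revert key
    generalize subdiv m n (tbd _ n (Finsupp.single w 1)) = x
    intro hx
    rw [Finsupp.supported_eq_span_single] at hx
    refine Submodule.span_induction (p := fun x _ => cone (bary w) n x ∈ _) ?_ ?_ ?_ ?_ hx
    · rintro _ ⟨v, hv, rfl⟩
      rw [cone_single]
      have hb : ∀ i, dist (v i) (bary w) ≤ ((n + 1 : ℕ) : ℝ) / ((n + 1 : ℕ) + 1) * d :=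
        fun i => convexHull_subset_closedBall_bary w hw (hv.2 i)
      refine Finsupp.single_mem_supported _ _ ⟨fun i j => ?_, fun i => ?_⟩
      · cases i using Fin.cases <;> cases j using Fin.cases
        · simp only [Fin.cons_zero, dist_self]; positivity
        · simp only [Fin.cons_zero, Fin.cons_succ]; rw [dist_comm]; exact hb _
        · simp only [Fin.cons_zero, Fin.cons_succ]; exact hb _
        · simp only [Fin.cons_succ]; exact (hv.1 _ _).trans hle
      · cases i using Fin.cases
        · exact aff_val_mem_convexHull w _
        · exact hv.2 _
    · rw [map_zero]; exact Submodule.zero_mem _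
    · intro x y _ _ hx hy; rw [map_add]; exact Submodule.add_mem _ hx hy
    · intro a x _ hx; rw [map_smul]; exact Submodule.smul_mem _ _ hx

theorem subdiv_iterate_mem (m n k : ℕ) {d : ℝ} {x : Tup (Simplex m) n}
    (hx : x ∈ Finsupp.supported ℤ ℤ {v : Fin (n + 1) → Simplex m | ∀ i j, dist (v i) (v j) ≤ d}) :
    (subdiv m n)^[k] x ∈ Finsupp.supported ℤ ℤ
      {v : Fin (n + 1) → Simplex m | ∀ i j, dist (v i) (v j) ≤ (n / (n + 1)) ^ k * d} := by
  induction k generalizing d x with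
  | zero => simpa using hx
  | succ k ih =>
    rw [Function.iterate_succ_apply, pow_succ, mul_assoc]
    refine ih ?_
    rw [Finsupp.supported_eq_span_single] at hx
    refine Submodule.span_induction (p := fun x _ => subdiv m n x ∈ _) ?_ ?_ ?_ ?_ hx
    · rintro _ ⟨v, hv, rfl⟩
      exact Finsupp.supported_mono (fun v hv => hv.1) (subdiv_single_mem v hv)
    · rw [map_zero]; exact Submodule.zero_mem _
    · intro x y _ _ hx hy; rw [map_add]; exact Submodule.add_mem _ hx hy
    · intro a x _ hx; rw [map_smul]; exact Submodule.smul_mem _ _ hx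

end Mesh

/-! ### Chains subordinate to an open cover -/

section Small

variable {X : Type} [TopologicalSpace X] {ι : Type} (c : ι → Set X)

/-- The chains of singular simplices contained in one of the sets `c i`. -/
def smallChains (n : ℕ) : Submodule ℤ (SChain X n) :=
  Finsupp.supported ℤ ℤ {ς : C(Simplex n, X) | ∃ i, ∀ t, ς t ∈ c i}

variable {c}

theorem realChain_mem_smallChains {m n : ℕ} {ς : C(Simplex m, X)} (hς : ∃ i, ∀ t, ς t ∈ c i)
    (x : Tup (Simplex m) n) : realChain ς n x ∈ smallChains c n := by
  induction x using Finsupp.induction_linear with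
  | zero => rw [map_zero]; exact Submodule.zero_mem _
  | add x y hx hy => rw [map_add]; exact Submodule.add_mem _ hx hy
  | single w r =>
    rw [realChain_single]
    exact Finsupp.single_mem_supported _ _ (hς.imp fun i h t => h _)

theorem map_mem_smallChains {n k : ℕ} (f : SChain X n →ₗ[ℤ] SChain X k)
    (hf : ∀ ς : C(Simplex n, X), (∃ i, ∀ t, ς t ∈ c i) →
      f (Finsupp.single ς 1) ∈ smallChains c k)
    {x : SChain X n} (hx : x ∈ smallChains c n) : f x ∈ smallChains c k := by
  rw [smallChains, Finsupp.supported_eq_span_single] at hx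
  have := Submodule.mem_map_of_mem (f := f) hx
  rw [Submodule.map_span] at this
  refine Submodule.span_le.2 ?_ this
  rintro _ ⟨_, ⟨ς, hς, rfl⟩, rfl⟩
  exact hf ς hς

theorem sd_mem_smallChains {n : ℕ} {x : SChain X n} (hx : x ∈ smallChains c n) :
    sd X n x ∈ smallChains c n :=
  map_mem_smallChains _ (fun ς hς => by
    rw [sd_single]; exact realChain_mem_smallChains hς _) hx

theorem sdHtpy_mem_smallChains {n : ℕ} {x : SChain X n} (hx : x ∈ smallChains c n) :
    sdHtpy X n x ∈ smallChains c (n + 1) :=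
  map_mem_smallChains _ (fun ς hς => by
    rw [sdHtpy_single]; exact realChain_mem_smallChains hς _) hx

theorem sd_iterate_mem_smallChains {n : ℕ} {x : SChain X n} (hx : x ∈ smallChains c n) (k : ℕ) :
    (sd X n)^[k] x ∈ smallChains c n := by
  induction k with
  | zero => exact hx
  | succ k ih => rw [Function.iterate_succ_apply']; exact sd_mem_smallChains ih

theorem sd_iterate_realChain {m : ℕ} (ς : C(Simplex m, X)) (n : ℕ) (x : Tup (Simplex m) n) (k : ℕ) :
    (sd X n)^[k] (realChain ς n x) = realChain ς n ((subdiv m n)^[k] x) := by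
  induction k with
  | zero => rfl
  | succ k ih => rw [Function.iterate_succ_apply', Function.iterate_succ_apply', ih, sd_realChain]

/-- Subdivide until the mesh is below a Lebesgue number of the cover pulled back to the simplex. -/
theorem exists_sd_iterate_single_mem (hc : ∀ i, IsOpen (c i)) (hcov : ⋃ i, c i = Set.univ) {n : ℕ}
    (ς : C(Simplex n, X)) :
    ∃ k, (sd X n)^[k] (Finsupp.single ς 1) ∈ smallChains c n := by
  obtain ⟨δ, hδ, hball⟩ := lebesgue_number_lemma_of_metric (s := (Set.univ : Set (Simplex n)))
    (c := fun i => ς ⁻¹' c i) isCompact_univ (fun i => (hc i).preimage ς.continuous) (by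
      rw [← Set.preimage_iUnion, hcov, Set.preimage_univ])
  have hlt : (n : ℝ) / (n + 1) < 1 := by rw [div_lt_one (by positivity)]; linarith
  have hlim := (tendsto_pow_atTop_nhds_zero_of_lt_one (by positivity) hlt).mul_const
    (Metric.diam (Set.univ : Set (Simplex n)))
  rw [zero_mul] at hlim
  obtain ⟨k, hk⟩ := (hlim.eventually (gt_mem_nhds hδ)).exists
  refine ⟨k, ?_⟩
  rw [← realChain_vertices, sd_iterate_realChain]
  have hmem := subdiv_iterate_mem n n k (x := Finsupp.single (vertices n) 1)
    (Finsupp.single_mem_supported _ _ fun i j => Metric.dist_le_diam_of_mem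
      (isCompact_univ (X := Simplex n)).isBounded (Set.mem_univ _) (Set.mem_univ _))
  rw [Finsupp.supported_eq_span_single] at hmem
  have := Submodule.mem_map_of_mem (f := realChain ς n) hmem
  rw [Submodule.map_span] at this
  refine Submodule.span_le.2 ?_ this
  rintro _ ⟨_, ⟨v, hv, rfl⟩, rfl⟩
  rw [realChain_single]
  obtain ⟨i, hi⟩ := hball (v 0) (Set.mem_univ _)
  refine Finsupp.single_mem_supported _ _ ⟨i, fun t => hi ?_⟩
  have hsub : convexHull ℝ (Set.range fun i => (v i).1) ⊆ Metric.ball (v 0).1 δ := by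
    refine convexHull_min ?_ (convex_ball _ _)
    rintro _ ⟨j, rfl⟩
    exact (hv j 0).trans_lt hk
  exact hsub (aff_val_mem_convexHull v t)

theorem exists_sd_iterate_mem (hc : ∀ i, IsOpen (c i)) (hcov : ⋃ i, c i = Set.univ) {n : ℕ}
    (x : SChain X n) : ∃ k, (sd X n)^[k] x ∈ smallChains c n := by
  induction x using Finsupp.induction_linear with
  | zero => exact ⟨0, Submodule.zero_mem _⟩
  | add x y hx hy =>
    obtain ⟨k, hk⟩ := hx
    obtain ⟨l, hl⟩ := hy
    -- Further subdivision keeps small chains small, so the exponents may be added.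
    refine ⟨k + l, ?_⟩
    rw [iterate_map_add]
    refine Submodule.add_mem _ ?_ ?_
    · rw [add_comm k l, Function.iterate_add_apply]
      exact sd_iterate_mem_smallChains hk l
    · rw [Function.iterate_add_apply]
      exact sd_iterate_mem_smallChains hl k
  | single ς r =>
    obtain ⟨k, hk⟩ := exists_sd_iterate_single_mem hc hcov ς
    refine ⟨k, ?_⟩
    rw [← mul_one r, ← smul_eq_mul, ← Finsupp.smul_single, ← Module.End.pow_apply, map_smul,
      Module.End.pow_apply]
    exact Submodule.smul_mem _ _ hk

/-- Every singular cycle is homologous to a small one. -/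
theorem exists_small_homologous (hc : ∀ i, IsOpen (c i)) (hcov : ⋃ i, c i = Set.univ) {n : ℕ}
    (z : SChain X (n + 1)) (hz : sbd X n z = 0) :
    ∃ y : SChain X (n + 2), z - sbd X (n + 1) y ∈ smallChains c (n + 1) := by
  obtain ⟨k, hk⟩ := exists_sd_iterate_mem hc hcov z
  induction k generalizing z with
  | zero => exact ⟨0, by simpa using hk⟩
  | succ k ih =>
    obtain ⟨y, hy⟩ := ih (sd X (n + 1) z) (by rw [sbd_sd, hz, map_zero]) hk
    -- On a cycle the homotopy formula reads $\partial Tz=z-Sz$; then `y` treats the cycle $Sz$.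
    refine ⟨sdHtpy X (n + 1) z + y, ?_⟩
    have h := sbd_sdHtpy n z
    rw [hz, map_zero, add_zero] at h
    rw [map_add, h, ← sub_sub, sub_sub_cancel]
    exact hy

/-- A small chain that bounds also bounds a small chain. -/
theorem exists_small_bounding (hc : ∀ i, IsOpen (c i)) (hcov : ⋃ i, c i = Set.univ) {n : ℕ}
    (y : SChain X (n + 1)) (hz : sbd X n y ∈ smallChains c n) :
    ∃ y' ∈ smallChains c (n + 1), sbd X n y' = sbd X n y := by
  obtain ⟨k, hk⟩ := exists_sd_iterate_mem hc hcov y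
  induction k generalizing y with
  | zero => exact ⟨y, hk, rfl⟩
  | succ k ih =>
    obtain ⟨y', hy', h⟩ := ih (sd X (n + 1) y) (by rw [sbd_sd]; exact sd_mem_smallChains hz) hk
    rw [sbd_sd] at h
    -- `y'` bounds only the subdivision of $\partial y$; the difference from $\partial y$ bounds
    -- $T\partial y$, which is small because $\partial y$ is.
    refine ⟨y' + sdHtpy X n (sbd X n y), Submodule.add_mem _ hy' (sdHtpy_mem_smallChains hz), ?_⟩
    rw [map_add, h]
    cases n with
    | zero =>
      -- The homotopy formula is stated in positive degrees, so here it is taken for `y` in degree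
      -- one and its boundary is formed.
      have h0 := sbd_sdHtpy 0 y
      have := congrArg (sbd X 0) h0
      rw [map_add, sbd_sbd, zero_add, map_sub, sbd_sd] at this
      rw [this, add_sub_cancel]
    | succ n =>
      have h := sbd_sdHtpy n (sbd X (n + 1) y)
      rw [sbd_sbd, map_zero, add_zero] at h
      rw [h, add_sub_cancel]

end Small

/-! ### Homology classes through representing cycles -/

section HomologyElements

open HomologicalComplex

variable {K L : ChainComplex (ModuleCat.{0} ℤ) ℕ}

theorem exists_homologyπ_eq (j : ℕ) (x : K.homology j) : ∃ z : K.cycles j, K.homologyπ j z = x :=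
  (ModuleCat.epi_iff_surjective _).1 inferInstance x

theorem d_iCycles_apply (j k : ℕ) (z : K.cycles j) : K.d j k (K.iCycles j z) = 0 :=
  congr($(K.iCycles_d j k).hom z)

theorem exists_iCycles_eq {j k : ℕ} (hk : (ComplexShape.down ℕ).next j = k) (z : K.X j)
    (hz : K.d j k z = 0) : ∃ z' : K.cycles j, K.iCycles j z' = z := by
  let f : ModuleCat.of ℤ ℤ ⟶ K.X j := ModuleCat.ofHom (LinearMap.toSpanSingleton ℤ _ z)
  have hf : f ≫ K.d j k = 0 := by
    ext
    simp [f, hz]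
  refine ⟨K.liftCycles f k hk hf (1 : ℤ), ?_⟩
  have := congr($(K.liftCycles_i f k hk hf).hom (1 : ℤ))
  exact this.trans (LinearMap.toSpanSingleton_apply_one _ _ _)

theorem homologyπ_eq_zero_iff {i j : ℕ} (hi : (ComplexShape.down ℕ).prev j = i)
    (z : K.cycles j) : K.homologyπ j z = 0 ↔ ∃ y : K.X i, K.d i j y = K.iCycles j z := by
  constructor
  · intro h
    have hex : (ShortComplex.mk (K.toCycles i j) (K.homologyπ j) (by simp)).Exact :=
      ShortComplex.exact_of_g_is_cokernel _ (K.homologyIsCokernel i j hi)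
    obtain ⟨y, hy⟩ := (ShortComplex.moduleCat_exact_iff _).1 hex z h
    refine ⟨y, ?_⟩
    have := congr($(K.toCycles_i i j).hom y)
    exact this.symm.trans (congrArg (K.iCycles j) hy)
  · rintro ⟨y, hy⟩
    have h1 : K.toCycles i j y = z := by
      refine (ModuleCat.mono_iff_injective (K.iCycles j)).1 inferInstance ?_
      exact congr($(K.toCycles_i i j).hom y).trans hy
    rw [← h1]
    exact congr($(K.toCycles_comp_homologyπ i j).hom y)

theorem homologyMap_bijective (φ : K ⟶ L) {i j k : ℕ} (hi : (ComplexShape.down ℕ).prev j = i)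
    (hk : (ComplexShape.down ℕ).next j = k)
    (hinj : ∀ (x : K.X j) (w : L.X i), K.d j k x = 0 → φ.f j x = L.d i j w →
      ∃ v, K.d i j v = x)
    (hsurj : ∀ y : L.X j, L.d j k y = 0 →
      ∃ x w, K.d j k x = 0 ∧ φ.f j x = y + L.d i j w) :
    Function.Bijective (homologyMap φ j) := by
  have hnat (z : K.cycles j) :
      homologyMap φ j (K.homologyπ j z) = L.homologyπ j (cyclesMap φ j z) :=
    congr($(homologyπ_naturality φ j).hom z)
  have hcyc (z : K.cycles j) : L.iCycles j (cyclesMap φ j z) = φ.f j (K.iCycles j z) :=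
    congr($(cyclesMap_i φ j).hom z)
  constructor
  · rw [injective_iff_map_eq_zero]
    intro x hx
    obtain ⟨z, rfl⟩ := exists_homologyπ_eq j x
    rw [hnat, homologyπ_eq_zero_iff hi] at hx
    obtain ⟨w, hw⟩ := hx
    rw [homologyπ_eq_zero_iff hi]
    exact hinj _ w (d_iCycles_apply _ _ _) (by rw [hw, hcyc])
  · intro y
    obtain ⟨z, rfl⟩ := exists_homologyπ_eq j y
    obtain ⟨x, w, hx, h⟩ := hsurj (L.iCycles j z) (d_iCycles_apply _ _ _)
    obtain ⟨x', rfl⟩ := exists_iCycles_eq hk x hx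
    refine ⟨K.homologyπ j x', ?_⟩
    rw [hnat, ← sub_eq_zero, ← map_sub, homologyπ_eq_zero_iff hi]
    refine ⟨w, ?_⟩
    rw [map_sub, hcyc, h, add_sub_cancel_left]

end HomologyElements

/-! ### A Mayer–Vietoris sequence split by a projection -/

section MayerVietoris

open HomologicalComplex

variable {AB A B M P : ChainComplex (ModuleCat.{0} ℤ) ℕ}

/-- The isomorphism is $x\mapsto(r_*x,\delta x)$. A class killed by $\delta$ comes from $A\oplus B$,
even from $A$, where $r_*$ is injective. Conversely, a class of the kernel dies in $A$ and in $B$,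
hence is some $\delta x_0$. -/
theorem nonempty_homology_equiv_prod_ker (a : AB ⟶ A) (b : AB ⟶ B) (c : A ⟶ M) (d : B ⟶ M)
    (w : biprod.lift a (-b) ≫ biprod.desc c d = 0)
    (hS : (ShortComplex.mk (biprod.lift a (-b)) (biprod.desc c d) w).ShortExact) (r : M ⟶ P)
    (hA : ∀ n, Function.Bijective (homologyMap (c ≫ r) n))
    (hB : ∀ n, Function.Bijective (homologyMap (d ≫ r) n))
    (hAB : ∀ n, Function.Surjective (homologyMap (a ≫ c ≫ r) n)) (n : ℕ) :
    Nonempty (M.homology (n + 1) ≃+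
      P.homology (n + 1) × (homologyMap (a ≫ c ≫ r) n).hom.toAddMonoidHom.ker) := by
  have hw : a ≫ c = b ≫ d := by
    simpa [sub_eq_zero, ← sub_eq_add_neg] using w
  have hf (m : ℕ) (z : AB.homology m) : homologyMap (biprod.lift a (-b)) m z =
      homologyMap (biprod.inl : A ⟶ A ⊞ B) m (homologyMap a m z) -
        homologyMap (biprod.inr : B ⟶ A ⊞ B) m (homologyMap b m z) := by
    have : biprod.lift a (-b) = a ≫ biprod.inl - b ≫ biprod.inr := by
      apply biprod.hom_ext <;> simp
    rw [this, homologyMap_sub, homologyMap_comp, homologyMap_comp]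
    rfl
  have hg (m : ℕ) (e : (A ⊞ B).homology m) : homologyMap (biprod.desc c d) m e =
      homologyMap c m (homologyMap (biprod.fst : A ⊞ B ⟶ A) m e) +
        homologyMap d m (homologyMap (biprod.snd : A ⊞ B ⟶ B) m e) := by
    have : biprod.desc c d = biprod.fst ≫ c + biprod.snd ≫ d := by
      apply biprod.hom_ext' <;> simp
    rw [this, homologyMap_add, homologyMap_comp, homologyMap_comp]
    rfl
  have hcr (m : ℕ) (x : A.homology m) :
      homologyMap r m (homologyMap c m x) = homologyMap (c ≫ r) m x :=
    congr($(homologyMap_comp c r m).hom x).symm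
  have hq (m : ℕ) (x : AB.homology m) :
      homologyMap (a ≫ c ≫ r) m x = homologyMap (c ≫ r) m (homologyMap a m x) :=
    congr($(homologyMap_comp a (c ≫ r) m).hom x)
  have hq' (m : ℕ) (x : AB.homology m) :
      homologyMap (a ≫ c ≫ r) m x = homologyMap (d ≫ r) m (homologyMap b m x) := by
    rw [← Category.assoc, hw, Category.assoc]
    exact congr($(homologyMap_comp b (d ≫ r) m).hom x)
  have hdb (m : ℕ) (x : AB.homology m) :
      homologyMap d m (homologyMap b m x) = homologyMap c m (homologyMap a m x) :=
    (congr($(homologyMap_comp b d m).hom x).symm.trans (by rw [← hw])).trans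
      (congr($(homologyMap_comp a c m).hom x))
  have hker (m : ℕ) (z : AB.homology m) (hz : homologyMap (a ≫ c ≫ r) m z = 0) :
      homologyMap a m z = 0 ∧ homologyMap b m z = 0 :=
    ⟨(hA m).1 (by rw [← hq, hz, map_zero]), (hB m).1 (by rw [← hq', hz, map_zero])⟩
  -- A class of $B$ lifts to $AB$, since $AB$ surjects onto the homology of $P$ and $B\to P$ is
  -- injective there; so its image in $M$ also comes from $A$.
  have hrange (m : ℕ) (e : (A ⊞ B).homology m) :
      ∃ x : A.homology m, homologyMap c m x = homologyMap (biprod.desc c d) m e := by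
    obtain ⟨z, hz⟩ := hAB m (homologyMap (d ≫ r) m (homologyMap (biprod.snd : A ⊞ B ⟶ B) m e))
    rw [hq'] at hz
    refine ⟨homologyMap (biprod.fst : A ⊞ B ⟶ A) m e + homologyMap a m z, ?_⟩
    rw [hg, map_add, ← hdb, (hB m).1 hz]
  have hrel : (ComplexShape.down ℕ).Rel (n + 1) n := rfl
  let δ := hS.δ (n + 1) n hrel
  have hδ (x : M.homology (n + 1)) : homologyMap (a ≫ c ≫ r) n (δ x) = 0 := by
    have h0 : homologyMap (biprod.lift a (-b)) n (δ x) = 0 :=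
      congr($(hS.δ_comp (n + 1) n hrel).hom x)
    have h1 : homologyMap (biprod.lift a (-b) ≫ biprod.fst) n (δ x) = 0 := by
      rw [homologyMap_comp, ConcreteCategory.comp_apply, h0, map_zero]
    rw [biprod.lift_fst] at h1
    rw [hq, h1, map_zero]
  refine ⟨AddEquiv.ofBijective ((homologyMap r (n + 1)).hom.toAddMonoidHom.prod
    (δ.hom.toAddMonoidHom.codRestrict (homologyMap (a ≫ c ≫ r) n).hom.toAddMonoidHom.ker hδ))
    ⟨?_, ?_⟩⟩
  · rw [injective_iff_map_eq_zero]
    intro x hx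
    have hx1 : homologyMap r (n + 1) x = 0 := congrArg Prod.fst hx
    have hx2 : δ x = 0 := congrArg (fun y => (Prod.snd y).1) hx
    obtain ⟨e, he⟩ := (ShortComplex.moduleCat_exact_iff _).1
      (hS.homology_exact₃ (n + 1) n hrel) x hx2
    obtain ⟨y, hy⟩ := hrange _ e
    have hyx : homologyMap c (n + 1) y = x := hy.trans he
    rw [← hyx, hcr] at hx1
    rw [← hyx, (hA _).1 (hx1.trans (map_zero _).symm), map_zero]
  · rintro ⟨u, ⟨k, hk⟩⟩
    obtain ⟨ha, hb⟩ := hker n k hk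
    obtain ⟨x₀, hx₀⟩ := (ShortComplex.moduleCat_exact_iff _).1
      (hS.homology_exact₁ (n + 1) n hrel) k (by
        refine (hf n k).trans ?_
        rw [ha, hb, map_zero, map_zero, sub_zero])
    -- A class from $A$ corrects the first component without changing $\delta$.
    obtain ⟨y, hy⟩ := (hA (n + 1)).2 (u - homologyMap r (n + 1) x₀)
    refine ⟨x₀ + homologyMap c (n + 1) y, Prod.ext ?_ (Subtype.ext ?_)⟩
    · change homologyMap r (n + 1) (x₀ + homologyMap c (n + 1) y) = u
      rw [map_add, hcr, hy, add_sub_cancel]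
    · change δ (x₀ + homologyMap c (n + 1) y) = k
      have h0 : δ (homologyMap c (n + 1) y) = 0 := by
        have h1 : homologyMap c (n + 1) y = homologyMap (biprod.desc c d) (n + 1)
            (homologyMap (biprod.inl : A ⟶ A ⊞ B) (n + 1) y) := by
          rw [← ConcreteCategory.comp_apply, ← homologyMap_comp, biprod.inl_desc]
        rw [h1]
        exact congr($(hS.comp_δ (n + 1) n hrel).hom _)
      rw [map_add, h0, add_zero]
      exact hx₀

end MayerVietoris

/-! ### Small simplices compute singular homology -/

section SmallSimplices

variable {X : Type} [TopologicalSpace X] {ι : Type} (c : ι → Set X)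

/-- The simplicial set of singular simplices contained in one of the sets `c i`. -/
noncomputable def smallSet : SSet.{0} where
  obj n := {ς : C(Simplex n.unop.len, X) // ∃ i, ∀ t, ς t ∈ c i}
  map f := ↾ fun ς => ⟨ς.1.comp (simplexMap f.unop), ς.2.imp fun _ h _ => h _⟩
  map_id _ := ConcreteCategory.hom_ext _ _ fun ς => Subtype.ext
    (congrArg (ContinuousMap.comp ς.1) (simplexMap_id _))
  map_comp f g := ConcreteCategory.hom_ext _ _ fun ς => Subtype.ext
    (congrArg (ContinuousMap.comp ς.1) (simplexMap_comp g.unop f.unop))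

/-- The inclusion of the small singular simplices. -/
noncomputable def smallIncl : smallSet c ⟶ singSetObj X where
  app n := ↾ fun ς : {ς : C(Simplex n.unop.len, X) // ∃ i, ∀ t, ς t ∈ c i} => ς.1

/-- The singular simplices of one of the sets `c i` are small. -/
noncomputable def toSmall (i : ι) : singSetObj (c i) ⟶ smallSet c where
  app n := ↾ fun ς : C(Simplex n.unop.len, c i) =>
    ⟨(⟨Subtype.val, continuous_subtype_val⟩ : C(c i, X)).comp ς, i, fun t => (ς t).2⟩

variable {c}

theorem exists_lmapDomain_val_eq {S : Type} {p : S → Prop} (x : S →₀ ℤ)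
    (hx : x ∈ Finsupp.supported ℤ ℤ {s | p s}) :
    ∃ y : {s // p s} →₀ ℤ, Finsupp.lmapDomain ℤ ℤ Subtype.val y = x := by
  refine ⟨Finsupp.comapDomain Subtype.val x Subtype.val_injective.injOn, ?_⟩
  refine Finsupp.mapDomain_comapDomain _ Subtype.val_injective _ fun s hs => ?_
  exact ⟨⟨s, (Finsupp.mem_supported ℤ x).1 hx hs⟩, rfl⟩

theorem lmapDomain_val_mem {S : Type} {p : S → Prop} (y : {s // p s} →₀ ℤ) :
    Finsupp.lmapDomain ℤ ℤ Subtype.val y ∈ Finsupp.supported ℤ ℤ {s | p s} := by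
  classical
  rw [Finsupp.mem_supported]
  refine (Finset.coe_subset.2 Finsupp.mapDomain_support).trans ?_
  intro s hs
  obtain ⟨t, -, rfl⟩ := Finset.mem_image.1 hs
  exact t.2

theorem homologyMap_smallIncl_bijective (hc : ∀ i, IsOpen (c i)) (hcov : ⋃ i, c i = Set.univ)
    (n : ℕ) :
    Function.Bijective (HomologicalComplex.homologyMap (freeChains.map (smallIncl c)) (n + 1)) := by
  let f (m : ℕ) : ({ς : C(Simplex m, X) // ∃ i, ∀ t, ς t ∈ c i} →₀ ℤ) →ₗ[ℤ] SChain X m :=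
    Finsupp.lmapDomain ℤ ℤ Subtype.val
  let dS (m : ℕ) : ({ς : C(Simplex (m + 1), X) // ∃ i, ∀ t, ς t ∈ c i} →₀ ℤ) →ₗ[ℤ]
      ({ς : C(Simplex m, X) // ∃ i, ∀ t, ς t ∈ c i} →₀ ℤ) := bdry (smallSet c) m
  have hf (m) : Function.Injective (f m) := Finsupp.mapDomain_injective Subtype.val_injective
  have hd (m x) : sbd X m (f (m + 1) x) = f m (dS m x) := bdry_map (smallIncl c) m x
  have hinj (x) (w : SChain X (n + 2)) (_ : dS n x = 0) (h : f (n + 1) x = sbd X (n + 1) w) :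
      ∃ v, dS (n + 1) v = x := by
    obtain ⟨w', hw', e⟩ := exists_small_bounding hc hcov w (by
      rw [← h]; exact lmapDomain_val_mem x)
    obtain ⟨v, rfl⟩ := exists_lmapDomain_val_eq w' hw'
    exact ⟨v, hf _ ((hd _ _).symm.trans (e.trans h.symm))⟩
  have hsurj (y : SChain X (n + 1)) (hy : sbd X n y = 0) :
      ∃ x w, dS n x = 0 ∧ f (n + 1) x = y + sbd X (n + 1) w := by
    obtain ⟨w, hw⟩ := exists_small_homologous hc hcov y hy
    obtain ⟨x, hx⟩ := exists_lmapDomain_val_eq _ hw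
    have hx : f (n + 1) x = y - sbd X (n + 1) w := hx
    refine ⟨x, -w, hf _ ?_, ?_⟩
    · rw [← hd, hx, map_sub, hy, sbd_sbd, sub_zero, map_zero]
    · rw [hx, map_neg, sub_eq_add_neg]
  refine homologyMap_bijective _ (i := n + 2) (k := n) (by simp) (by simp) ?_ ?_
  · intro x w hx h
    rw [freeChains_d] at hx h ⊢
    exact hinj x w hx h
  · intro y hy
    rw [freeChains_d] at hy ⊢
    obtain ⟨x, w, h⟩ := hsurj y hy
    refine ⟨x, w, ?_⟩
    rw [freeChains_d]
    exact h

end SmallSimplices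

/-! ### Mayer–Vietoris for a cover by two open sets -/

section SpaceMayerVietoris

open HomologicalComplex

/-- The singular chain complex of a space. -/
noncomputable abbrev chains (X : Type) [TopologicalSpace X] : ChainComplex (ModuleCat.{0} ℤ) ℕ :=
  freeChains.obj (singSetObj X)

/-- The map of singular chain complexes induced by a continuous map. -/
noncomputable abbrev chainsMap {X Y : Type} [TopologicalSpace X] [TopologicalSpace Y]
    (f : C(X, Y)) : chains X ⟶ chains Y :=
  freeChains.map (singSetMap f)

/-- If the two images cancel, each basis element in the support of `x` has its image in the range of
`d`, hence lies in the pullback. This is exactness in the middle. -/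
theorem exists_mapDomain_of_pullback {S₀ S₁ S₂ S : Type} {a : S₀ → S₁} {b : S₀ → S₂} {c : S₁ → S}
    {d : S₂ → S} (hc : c.Injective) (hd : d.Injective) (ha : a.Injective)
    (hcomm : ∀ z, c (a z) = d (b z)) (hpb : ∀ x y, c x = d y → ∃ z, a z = x) (x : S₁ →₀ ℤ)
    (y : S₂ →₀ ℤ) (h : x.mapDomain c + y.mapDomain d = 0) :
    ∃ z : S₀ →₀ ℤ, z.mapDomain a = x ∧ -z.mapDomain b = y := by
  have hz : (Finsupp.comapDomain a x ha.injOn).mapDomain a = x := by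
    refine Finsupp.mapDomain_comapDomain a ha x fun s hs => ?_
    have h1 : y.mapDomain d (c s) ≠ 0 := by
      rw [← neg_eq_of_add_eq_zero_right h, Finsupp.neg_apply, Finsupp.mapDomain_apply hc]
      exact neg_ne_zero.2 (Finsupp.mem_support_iff.1 hs)
    have h2 : c s ∈ Set.range d := by
      by_contra h2
      exact h1 (Finsupp.mapDomain_of_notMem_range _ _ h2)
    obtain ⟨t, ht⟩ := h2
    exact hpb s t ht.symm
  generalize Finsupp.comapDomain a x ha.injOn = z at hz
  refine ⟨z, hz, Finsupp.mapDomain_injective hd ?_⟩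
  rw [← neg_eq_of_add_eq_zero_right h, ← hz, ← Finsupp.mapDomain_comp,
    ← Finsupp.mapDomain.addMonoidHom_apply d, map_neg, Finsupp.mapDomain.addMonoidHom_apply,
    ← Finsupp.mapDomain_comp]
  congr 2
  exact funext fun z => (hcomm z).symm

theorem shortExact_of_pullback {K₀ K₁ K₂ K : SSet.{0}} (a : K₀ ⟶ K₁) (b : K₀ ⟶ K₂) (c : K₁ ⟶ K)
    (d : K₂ ⟶ K) (w : a ≫ c = b ≫ d)
    (ha : ∀ n, Function.Injective (a.app (op (SimplexCategory.mk n))))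
    (hc : ∀ n, Function.Injective (c.app (op (SimplexCategory.mk n))))
    (hd : ∀ n, Function.Injective (d.app (op (SimplexCategory.mk n))))
    (hpb : ∀ n x y, c.app (op (SimplexCategory.mk n)) x = d.app (op (SimplexCategory.mk n)) y →
      ∃ z, a.app (op (SimplexCategory.mk n)) z = x)
    (hsurj : ∀ n s, (∃ x, c.app (op (SimplexCategory.mk n)) x = s) ∨
      ∃ y, d.app (op (SimplexCategory.mk n)) y = s) :
    ∃ h : biprod.lift (freeChains.map a) (-freeChains.map b) ≫
      biprod.desc (freeChains.map c) (freeChains.map d) = 0,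
    (ShortComplex.mk (biprod.lift (freeChains.map a) (-freeChains.map b))
      (biprod.desc (freeChains.map c) (freeChains.map d)) h).ShortExact := by
  have h : biprod.lift (freeChains.map a) (-freeChains.map b) ≫
      biprod.desc (freeChains.map c) (freeChains.map d) = 0 := by
    rw [biprod.lift_desc, Preadditive.neg_comp, ← Functor.map_comp, ← Functor.map_comp, w,
      add_neg_cancel]
  refine ⟨h, ?_⟩
  have hmono : Mono (freeChains.map a) := by
    refine HomologicalComplex.mono_of_mono_f _ fun n => ?_
    rw [ModuleCat.mono_iff_injective]
    exact Finsupp.mapDomain_injective (ha n)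
  have hcd (n : ℕ) (x : (freeChains.obj K₁).X n) (y : (freeChains.obj K₂).X n) :
      (biprod.desc (freeChains.map c) (freeChains.map d)).f n
        ((biprod.inl : _ ⟶ freeChains.obj K₁ ⊞ freeChains.obj K₂).f n x +
          (biprod.inr : _ ⟶ freeChains.obj K₁ ⊞ freeChains.obj K₂).f n y) =
      (freeChains.map c).f n x + (freeChains.map d).f n y := by
    rw [map_add, ← ConcreteCategory.comp_apply, ← ConcreteCategory.comp_apply, ← comp_f, ← comp_f,
      biprod.inl_desc, biprod.inr_desc]
  have hsplit (n : ℕ) (e : (freeChains.obj K₁ ⊞ freeChains.obj K₂).X n) : e =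
        (biprod.inl : _ ⟶ freeChains.obj K₁ ⊞ freeChains.obj K₂).f n
          ((biprod.fst : freeChains.obj K₁ ⊞ freeChains.obj K₂ ⟶ _).f n e) +
          (biprod.inr : _ ⟶ freeChains.obj K₁ ⊞ freeChains.obj K₂).f n
          ((biprod.snd : freeChains.obj K₁ ⊞ freeChains.obj K₂ ⟶ _).f n e) := by
    have := congr(($(biprod.total (X := freeChains.obj K₁) (Y := freeChains.obj K₂)).f n).hom e)
    exact this.symm
  have hmono' : Mono (biprod.lift (freeChains.map a) (-freeChains.map b)) :=
    mono_of_mono_fac (biprod.lift_fst _ _)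
  have hepi : Epi (biprod.desc (freeChains.map c) (freeChains.map d)) := by
    refine HomologicalComplex.epi_of_epi_f _ fun n => ?_
    rw [ModuleCat.epi_iff_surjective]
    intro s
    have key : ∀ s : K.obj (op (SimplexCategory.mk n)) →₀ ℤ,
        ∃ x y, Finsupp.lmapDomain ℤ ℤ (c.app (op (SimplexCategory.mk n))) x +
          Finsupp.lmapDomain ℤ ℤ (d.app (op (SimplexCategory.mk n))) y = s := by
      intro s
      induction s using Finsupp.induction_linear with
      | zero => exact ⟨0, 0, by simp⟩
      | add s t hs ht =>
        obtain ⟨x, y, rfl⟩ := hs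
        obtain ⟨x', y', rfl⟩ := ht
        exact ⟨x + x', y + y', by simp only [map_add]; abel⟩
      | single s r =>
        obtain ⟨x, rfl⟩ | ⟨y, rfl⟩ := hsurj n s
        · exact ⟨Finsupp.single x r, 0, by simp⟩
        · exact ⟨0, Finsupp.single y r, by simp⟩
    obtain ⟨x, y, hxy⟩ := key s
    exact ⟨_, (hcd n x y).trans hxy⟩
  refine ShortComplex.ShortExact.mk' ?_ hmono' hepi
  refine HomologicalComplex.exact_of_degreewise_exact _ fun n => ?_
  rw [ShortComplex.moduleCat_exact_iff]
  intro e he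
  have he : (biprod.desc (freeChains.map c) (freeChains.map d)).f n e = 0 := he
  rw [hsplit n e, hcd] at he
  obtain ⟨z, hz₁, hz₂⟩ := exists_mapDomain_of_pullback (hc n) (hd n) (ha n)
    (b := b.app (op (SimplexCategory.mk n)))
    (fun z => congr($(w).app _ z)) (hpb n) _ _ he
  refine ⟨z, ?_⟩
  refine (hsplit n _).trans ((congrArg₂ (· + ·) (congrArg _ ?_) (congrArg _ ?_)).trans
    (hsplit n e).symm)
  · refine Eq.trans ?_ hz₁
    exact congr(($(biprod.lift_fst (freeChains.map a) (-freeChains.map b)).f n).hom z)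
  · refine Eq.trans ?_ hz₂
    exact congr(($(biprod.lift_snd (freeChains.map a) (-freeChains.map b)).f n).hom z)

theorem nonempty_homology_equiv_of_cover {X P : Type} [TopologicalSpace X] [TopologicalSpace P]
    {U V : Set X} (hU : IsOpen U) (hV : IsOpen V) (hUV : U ∪ V = Set.univ) (p : C(X, P))
    (hpU : ∀ n, Function.Bijective (homologyMap (chainsMap (p.restrict U)) n))
    (hpV : ∀ n, Function.Bijective (homologyMap (chainsMap (p.restrict V)) n))
    (hpUV : ∀ n, Function.Surjective (homologyMap (chainsMap (p.restrict (U ∩ V))) n)) (n : ℕ) :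
    Nonempty ((chains X).homology (n + 1) ≃+ (chains P).homology (n + 1) ×
      (homologyMap (chainsMap (p.restrict (U ∩ V))) n).hom.toAddMonoidHom.ker) := by
  let c : Bool → Set X := fun i => cond i U V
  have hc : ∀ i, IsOpen (c i) := by rintro (_ | _) <;> assumption
  have hcov : ⋃ i, c i = Set.univ := by rw [← hUV, Set.union_eq_iUnion]
  let iU : C((U ∩ V : Set X), U) := ⟨Set.inclusion Set.inter_subset_left, continuous_inclusion _⟩
  let iV : C((U ∩ V : Set X), V) := ⟨Set.inclusion Set.inter_subset_right, continuous_inclusion _⟩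
  let jU : singSetObj U ⟶ smallSet c := toSmall c true
  let jV : singSetObj V ⟶ smallSet c := toSmall c false
  have hinj (W : Set X) (n : ℕ) (ς τ : C(Simplex n, W))
      (h : (⟨Subtype.val, continuous_subtype_val⟩ : C(W, X)).comp ς =
        (⟨Subtype.val, continuous_subtype_val⟩ : C(W, X)).comp τ) : ς = τ :=
    (ContinuousMap.cancel_left Subtype.val_injective).1 h
  have hpb (n : ℕ) (ς : C(Simplex n, U)) (τ : C(Simplex n, V))
      (h : (⟨Subtype.val, continuous_subtype_val⟩ : C(U, X)).comp ς =
        (⟨Subtype.val, continuous_subtype_val⟩ : C(V, X)).comp τ) :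
      ∃ ρ : C(Simplex n, (U ∩ V : Set X)), iU.comp ρ = ς :=
    ⟨⟨fun t => ⟨(ς t).1, (ς t).2, by
      rw [show (ς t).1 = (τ t).1 from congr($h t)]; exact (τ t).2⟩, by fun_prop⟩, rfl⟩
  obtain ⟨w, hS⟩ := shortExact_of_pullback (singSetMap iU) (singSetMap iV) jU jV rfl
    (fun n ς τ h => (ContinuousMap.cancel_left (Set.inclusion_injective Set.inter_subset_left)).1 h)
    (fun n ς τ h => hinj U n ς τ (congrArg Subtype.val h))
    (fun n ς τ h => hinj V n ς τ (congrArg Subtype.val h))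
    (fun n ς τ h => hpb n ς τ (congrArg Subtype.val h))
    (by
      rintro n ⟨ς, _ | _, hi⟩
      · exact Or.inr ⟨(⟨fun t => ⟨ς t, hi t⟩, by fun_prop⟩ : C(Simplex n, V)), rfl⟩
      · exact Or.inl ⟨(⟨fun t => ⟨ς t, hi t⟩, by fun_prop⟩ : C(Simplex n, U)), rfl⟩)
  let r : freeChains.obj (smallSet c) ⟶ chains P := freeChains.map (smallIncl c ≫ singSetMap p)
  have hrU : freeChains.map jU ≫ r = chainsMap (p.restrict U) :=
    (freeChains.map_comp _ _).symm
  have hrV : freeChains.map jV ≫ r = chainsMap (p.restrict V) :=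
    (freeChains.map_comp _ _).symm
  have hr : freeChains.map (singSetMap iU) ≫ freeChains.map jU ≫ r =
      chainsMap (p.restrict (U ∩ V)) := by
    rw [hrU]
    exact (freeChains.map_comp _ _).symm
  rw [← hrU] at hpU
  rw [← hrV] at hpV
  rw [← hr] at hpUV ⊢
  obtain ⟨e⟩ := nonempty_homology_equiv_prod_ker _ _ _ _ w hS r hpU hpV hpUV n
  -- The exact sequence concerns small chains; subdivision replaces them by all chains.
  exact ⟨(AddEquiv.ofBijective
      (homologyMap (freeChains.map (smallIncl c)) (n + 1)).hom.toAddMonoidHom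
    (homologyMap_smallIncl_bijective hc hcov n)).symm.trans e⟩

end SpaceMayerVietoris

/-! ### Homotopy invariance, transported along `chainIso` -/

section HomotopyInvariance

open HomologicalComplex

variable {X Y Z : Type} [TopologicalSpace X] [TopologicalSpace Y] [TopologicalSpace Z]

theorem chainsMap_id : chainsMap (.id X) = 𝟙 (chains X) :=
  freeChains.map_id (singSetObj X)

theorem chainsMap_comp (g : C(Y, Z)) (f : C(X, Y)) :
    chainsMap (g.comp f) = chainsMap f ≫ chainsMap g :=
  freeChains.map_comp (singSetMap f) (singSetMap g)

theorem homologyMap_chainsMap_comp (g : C(Y, Z)) (f : C(X, Y)) (n : ℕ)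
    (x : (chains X).homology n) :
    homologyMap (chainsMap (g.comp f)) n x =
      homologyMap (chainsMap g) n (homologyMap (chainsMap f) n x) := by
  rw [chainsMap_comp, homologyMap_comp]
  rfl

theorem homologyMap_chainsMap_id (n : ℕ) (x : (chains X).homology n) :
    homologyMap (chainsMap (.id X)) n x = x := by
  rw [chainsMap_id, homologyMap_id]
  rfl

theorem homologyMap_chainsMap_eq_of_homotopic {f g : C(X, Y)} (h : f.Homotopic g) (n : ℕ) :
    homologyMap (chainsMap f) n = homologyMap (chainsMap g) n := by
  obtain ⟨H⟩ := h
  have h := TopCat.Homotopy.congr_homologyMap_singularChainComplexFunctor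
    (f := TopCat.ofHom f) (g := TopCat.ofHom g) H (ModuleCat.of ℤ ℤ) n
  have key (f : C(X, Y)) : chainsMap f = (chainIso.app (TopCat.of X)).inv ≫
      ((singularChainComplexFunctor (ModuleCat.{0} ℤ)).obj (ModuleCat.of ℤ ℤ)).map
        (TopCat.ofHom f) ≫ (chainIso.app (TopCat.of Y)).hom :=
    (chainIso.inv_hom_id_app_assoc _ _).symm.trans
      (congrArg _ (chainIso.hom.naturality (TopCat.ofHom f)).symm)
  have hk (f : C(X, Y)) : homologyMap (chainsMap f) n =
      homologyMap (chainIso.app (TopCat.of X)).inv n ≫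
        homologyMap (((singularChainComplexFunctor (ModuleCat.{0} ℤ)).obj (ModuleCat.of ℤ ℤ)).map
          (TopCat.ofHom f)) n ≫ homologyMap (chainIso.app (TopCat.of Y)).hom n :=
    (congrArg (fun φ => homologyMap φ n) (key f)).trans
      ((homologyMap_comp _ _ n).trans (congrArg _ (homologyMap_comp _ _ n)))
  exact (hk f).trans ((congrArg (fun y => homologyMap (chainIso.app (TopCat.of X)).inv n ≫ y ≫
    homologyMap (chainIso.app (TopCat.of Y)).hom n) h).trans (hk g).symm)

theorem homologyMap_chainsMap_bijective (f : C(X, Y)) (g : C(Y, X))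
    (hgf : (g.comp f).Homotopic (.id X)) (hfg : (f.comp g).Homotopic (.id Y)) (n : ℕ) :
    Function.Bijective (homologyMap (chainsMap f) n) := by
  refine Function.bijective_iff_has_inverse.2 ⟨homologyMap (chainsMap g) n, fun x => ?_,
    fun x => ?_⟩
  · rw [← homologyMap_chainsMap_comp, homologyMap_chainsMap_eq_of_homotopic hgf,
      homologyMap_chainsMap_id]
  · rw [← homologyMap_chainsMap_comp, homologyMap_chainsMap_eq_of_homotopic hfg,
      homologyMap_chainsMap_id]

/-- Singular homology is the homology of the complex of singular chains. -/
noncomputable def integralHomologyIso (n : ℕ) (X : Type) [TopologicalSpace X] :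
    integralHomology n X ≅ (chains X).homology n :=
  (homologyFunctor _ _ n).mapIso (chainIso.app (TopCat.of X))

end HomotopyInvariance

/-! ### Homology of a product with finitely many points -/

section Sheets

open HomologicalComplex

variable {P : Type} [TopologicalSpace P] {k : ℕ}

/-- The inclusion of a sheet into a product with a finite discrete space. -/
def sheetIncl (P : Type) [TopologicalSpace P] {k : ℕ} (j : Fin k) : C(P, P × Fin k) :=
  (ContinuousMap.id P).prodMk (.const P j)

/-- Simplices are connected, so a singular simplex and all its faces lie in one sheet. -/
theorem snd_eq_snd {n : ℕ} (ς : C(Simplex n, P × Fin k)) (s t : Simplex n) :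
    (ς s).2 = (ς t).2 :=
  PreconnectedSpace.constant inferInstance (f := fun t => (ς t).2) (by fun_prop)

open Classical in
/-- The projection of chains onto the sheet with index `j`, in degree `n`. -/
noncomputable def sheetProjLinear (P : Type) [TopologicalSpace P] {k : ℕ} (j : Fin k) (n : ℕ) :
    SChain (P × Fin k) n →ₗ[ℤ] SChain P n :=
  Finsupp.linearCombination ℤ fun ς =>
    if (ς (vertices n 0)).2 = j then Finsupp.single (ContinuousMap.fst.comp ς) 1 else 0

theorem sheetProjLinear_single_of_eq {n : ℕ} (ς : C(Simplex n, P × Fin k)) (j : Fin k)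
    (h : (ς (vertices n 0)).2 = j) :
    sheetProjLinear P j n (Finsupp.single ς 1) =
      Finsupp.single (ContinuousMap.fst.comp ς) 1 := by
  simp [sheetProjLinear, h]

theorem sheetProjLinear_single_of_ne {n : ℕ} (ς : C(Simplex n, P × Fin k)) (j : Fin k)
    (h : (ς (vertices n 0)).2 ≠ j) : sheetProjLinear P j n (Finsupp.single ς 1) = 0 := by
  simp [sheetProjLinear, h]

theorem sbd_sheetProjLinear (j : Fin k) (n : ℕ) (x : SChain (P × Fin k) (n + 1)) :
    sbd P n (sheetProjLinear P j (n + 1) x) = sheetProjLinear P j n (sbd _ n x) := by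
  suffices h : sbd P n ∘ₗ sheetProjLinear P j (n + 1) = sheetProjLinear P j n ∘ₗ sbd _ n from
    congr($h x)
  refine Finsupp.lhom_ext' fun ς => LinearMap.ext_ring ?_
  simp only [LinearMap.comp_apply, Finsupp.lsingle_apply]
  rw [sbd_single, map_sum]
  simp only [map_smul]
  by_cases h : (ς (vertices _ 0)).2 = j
  · rw [sheetProjLinear_single_of_eq ς j h, sbd_single]
    refine Finset.sum_congr rfl fun i _ => ?_
    rw [sheetProjLinear_single_of_eq (ς.comp _) j ((snd_eq_snd ς _ _).trans h),
      ContinuousMap.comp_assoc]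
  · rw [sheetProjLinear_single_of_ne ς j h, map_zero]
    refine (Finset.sum_eq_zero fun i _ => ?_).symm
    rw [sheetProjLinear_single_of_ne (ς.comp _) j fun h' => h ((snd_eq_snd ς _ _).trans h'),
      smul_zero]

/-- The projection of the singular chain complex onto the sheet with index `j`. -/
noncomputable def sheetProj (P : Type) [TopologicalSpace P] {k : ℕ} (j : Fin k) :
    chains (P × Fin k) ⟶ chains P where
  f n := ModuleCat.ofHom (sheetProjLinear P j n)
  comm' := by
    rintro _ n rfl
    rw [freeChains_d, freeChains_d]
    exact ModuleCat.hom_ext (LinearMap.ext fun x => sbd_sheetProjLinear j n x)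

theorem sheetIncl_sheetProj (j l : Fin k) :
    chainsMap (sheetIncl P j) ≫ sheetProj P l = if j = l then 𝟙 _ else 0 := by
  refine HomologicalComplex.hom_ext _ _ fun n => ModuleCat.hom_ext ?_
  refine Finsupp.lhom_ext' (M := ℤ) fun ς => LinearMap.ext_ring ?_
  have h (ς : C(Simplex n, P)) :
      sheetProjLinear P l n (Finsupp.mapDomain (sheetIncl P j).comp (Finsupp.single ς 1)) =
        if j = l then Finsupp.single ς 1 else 0 := by
    rw [Finsupp.mapDomain_single]
    split_ifs with h
    · exact sheetProjLinear_single_of_eq _ _ h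
    · exact sheetProjLinear_single_of_ne _ _ h
  refine (h ς).trans ?_
  split_ifs <;> rfl

theorem sum_sheetProj_sheetIncl :
    ∑ j : Fin k, sheetProj P j ≫ chainsMap (sheetIncl P j) = 𝟙 (chains (P × Fin k)) := by
  refine HomologicalComplex.hom_ext _ _ fun n => ModuleCat.hom_ext ?_
  refine Finsupp.lhom_ext' (M := ℤ) fun ς => LinearMap.ext_ring ?_
  have h (ς : C(Simplex n, P × Fin k)) :
      ∑ j : Fin k, Finsupp.mapDomain (sheetIncl P j).comp (sheetProjLinear P j n
        (Finsupp.single ς 1)) = Finsupp.single ς 1 := by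
    rw [Finset.sum_eq_single (ς (vertices n 0)).2]
    · rw [sheetProjLinear_single_of_eq _ _ rfl, Finsupp.mapDomain_single]
      congr 1
      ext t : 1
      exact Prod.ext rfl (snd_eq_snd ς _ _)
    · intro j _ hj
      rw [sheetProjLinear_single_of_ne _ _ hj.symm, Finsupp.mapDomain_zero]
    · simp
  refine Eq.trans ?_ (h ς)
  have hs : (∑ j : Fin k, sheetProj P j ≫ chainsMap (sheetIncl P j)).f n =
      ∑ j : Fin k, (sheetProj P j ≫ chainsMap (sheetIncl P j)).f n :=
    (HomologicalComplex.eval _ _ n).map_sum _ _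
  rw [hs, ModuleCat.hom_sum]
  exact (LinearMap.sum_apply _ _ _)

/-- In sheet coordinates the projection is the sum map. A tuple of sum zero is determined by its
entries other than the one with index `0`. -/
theorem nonempty_ker_fst_equiv (P : Type) [TopologicalSpace P] (k n : ℕ) :
    Nonempty ((homologyMap (chainsMap (ContinuousMap.fst : C(P × Fin (k + 1), P)))
      n).hom.toAddMonoidHom.ker ≃+ (Fin k → (chains P).homology n)) := by
  let q (j : Fin (k + 1)) := homologyMap (sheetProj P j) n
  let i (j : Fin (k + 1)) := homologyMap (chainsMap (sheetIncl P j)) n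
  let p := homologyMap (chainsMap (ContinuousMap.fst : C(P × Fin (k + 1), P))) n
  have hqi (j l) (x : (chains P).homology n) : q l (i j x) = if j = l then x else 0 := by
    have h : i j ≫ q l = _ := (homologyMap_comp _ _ n).symm
    rw [← ConcreteCategory.comp_apply, h, sheetIncl_sheetProj]
    split_ifs
    · rw [homologyMap_id]; rfl
    · rw [homologyMap_zero]; rfl
  have hiq (x) : ∑ j, i j (q j x) = x := by
    have h := congr(homologyMap $(sum_sheetProj_sheetIncl (P := P) (k := k + 1)) n)
    rw [homologyMap_id] at h
    have h2 : ∑ j, q j ≫ i j = 𝟙 _ := by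
      rw [← h]
      refine Eq.trans ?_ ((homologyFunctor _ _ n).map_sum _ _).symm
      exact Finset.sum_congr rfl fun j _ => (homologyMap_comp _ _ _).symm
    have h3 := congr($(h2).hom x)
    rw [ModuleCat.hom_sum] at h3
    exact (LinearMap.sum_apply _ _ _).symm.trans h3
  have hpi (j x) : p (i j x) = x := by
    refine (homologyMap_chainsMap_comp _ _ n x).symm.trans ?_
    exact homologyMap_chainsMap_id n x
  have hp (x) : p x = ∑ j, q j x := by
    conv_lhs => rw [← hiq x, map_sum]
    simp only [hpi]
  let Φ : p.hom.toAddMonoidHom.ker →+ (Fin k → (chains P).homology n) :=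
    { toFun x j := q j.succ x.1
      map_zero' := funext fun j => map_zero (q j.succ).hom
      map_add' x y := funext fun j => map_add (q j.succ).hom x.1 y.1 }
  refine ⟨AddEquiv.ofBijective Φ ⟨?_, ?_⟩⟩
  · rw [injective_iff_map_eq_zero]
    rintro ⟨x, hx⟩ h
    have hx : p x = 0 := hx
    have h (j : Fin k) : q j.succ x = 0 := congrFun h j
    rw [hp, Fin.sum_univ_succ] at hx
    simp only [h, Finset.sum_const_zero, add_zero] at hx
    refine Subtype.ext ?_
    change x = 0
    rw [← hiq x, Fin.sum_univ_succ, hx]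
    simp [h]
  · intro u
    -- Sheet `0` carries minus the sum of the other entries.
    refine ⟨⟨∑ j, i j.succ (u j) - i 0 (∑ j, u j), ?_⟩, ?_⟩
    · change p (∑ j, i j.succ (u j) - i 0 (∑ j, u j)) = 0
      rw [map_sub, hpi, map_sum]
      simp only [hpi, sub_self]
    · funext l
      change q l.succ (∑ j, i j.succ (u j) - i 0 (∑ j, u j)) = u l
      rw [map_sub, hqi, map_sum, if_neg (Fin.succ_ne_zero l).symm, sub_zero]
      simp [hqi]

end Sheets

/-! ### Products with a space covered by two contractible sets -/

section OverBase

open HomologicalComplex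

variable {P Q D : Type} [TopologicalSpace P] [TopologicalSpace Q] [TopologicalSpace D]

/-- The contraction of `W` is applied to the second factor only, so it is a homotopy over `P`. -/
theorem homologyMap_fst_restrict_bijective (W : Set Q) [ContractibleSpace W] (n : ℕ) :
    Function.Bijective (homologyMap (chainsMap
      ((ContinuousMap.fst : C(P × Q, P)).restrict (Prod.snd ⁻¹' W))) n) := by
  obtain ⟨q, ⟨F⟩⟩ := id_nullhomotopic W
  refine homologyMap_chainsMap_bijective _
    (⟨fun x => ⟨(x, q.1), q.2⟩, by fun_prop⟩ : C(P, (Prod.snd ⁻¹' W : Set (P × Q)))) ?_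
    (.refl _) n
  refine ContinuousMap.Homotopic.symm ⟨{
    toFun z := ⟨(z.2.1.1, (F (z.1, ⟨z.2.1.2, z.2.2⟩)).1), (F (z.1, ⟨z.2.1.2, z.2.2⟩)).2⟩
    continuous_toFun := by fun_prop
    map_zero_left z := ?_
    map_one_left z := ?_ }⟩
  · exact Subtype.ext (Prod.ext rfl congr(($(F.map_zero_left ⟨z.1.2, z.2⟩)).1))
  · exact Subtype.ext (Prod.ext rfl congr(($(F.map_one_left ⟨z.1.2, z.2⟩)).1))

/-- The map from a product to the part of a product over a subset of the second factor. -/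
def prodToPreimage (P : Type) [TopologicalSpace P] {W : Set Q} (v : C(D, W)) :
    C(P × D, (Prod.snd ⁻¹' W : Set (P × Q))) :=
  ⟨fun x => ⟨(x.1, (v x.2).1), (v x.2).2⟩, by fun_prop⟩

theorem homologyMap_prodToPreimage_bijective {W : Set Q} (u : C(W, D)) (v : C(D, W))
    (huv : (u.comp v).Homotopic (.id D)) (hvu : (v.comp u).Homotopic (.id W)) (n : ℕ) :
    Function.Bijective (homologyMap (chainsMap (prodToPreimage P v)) n) := by
  obtain ⟨F⟩ := huv
  obtain ⟨G⟩ := hvu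
  refine homologyMap_chainsMap_bijective _
    (⟨fun x => (x.1.1, u ⟨x.1.2, x.2⟩), by fun_prop⟩ : C((Prod.snd ⁻¹' W : Set (P × Q)), P × D))
    ⟨{ toFun z := (z.2.1, F (z.1, z.2.2))
       continuous_toFun := by fun_prop
       map_zero_left z := ?_
       map_one_left z := ?_ }⟩ ⟨{
    toFun z := ⟨(z.2.1.1, (G (z.1, ⟨z.2.1.2, z.2.2⟩)).1), (G (z.1, ⟨z.2.1.2, z.2.2⟩)).2⟩
    continuous_toFun := by fun_prop
    map_zero_left z := ?_
    map_one_left z := ?_ }⟩ n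
  · exact Prod.ext rfl (F.map_zero_left z.2)
  · exact Prod.ext rfl (F.map_one_left z.2)
  · exact Subtype.ext (Prod.ext rfl congr(($(G.map_zero_left ⟨z.1.2, z.2⟩)).1))
  · exact Subtype.ext (Prod.ext rfl congr(($(G.map_one_left ⟨z.1.2, z.2⟩)).1))

/-- The homology of a product with a space covered by two contractible open sets whose intersection
is homotopy equivalent to `k + 1` points. -/
theorem nonempty_homology_prod_equiv {U V : Set Q} (hU : IsOpen U) (hV : IsOpen V)
    (hUV : U ∪ V = Set.univ) [ContractibleSpace U] [ContractibleSpace V] {k : ℕ}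
    (u : C((U ∩ V : Set Q), Fin (k + 1))) (v : C(Fin (k + 1), (U ∩ V : Set Q)))
    (huv : (u.comp v).Homotopic (.id _)) (hvu : (v.comp u).Homotopic (.id _)) (n : ℕ) :
    Nonempty ((chains (P × Q)).homology (n + 1) ≃+
      (chains P).homology (n + 1) × (Fin k → (chains P).homology n)) := by
  let p : C((Prod.snd ⁻¹' (U ∩ V) : Set (P × Q)), P) :=
    (ContinuousMap.fst : C(P × Q, P)).restrict (Prod.snd ⁻¹' (U ∩ V))
  have hp (m : ℕ) (x) : homologyMap (chainsMap p) m
      (homologyMap (chainsMap (prodToPreimage P v)) m x) =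
        homologyMap (chainsMap (ContinuousMap.fst : C(P × Fin (k + 1), P))) m x :=
    (homologyMap_chainsMap_comp p (prodToPreimage P v) m x).symm
  have hsurj (m : ℕ) : Function.Surjective (homologyMap (chainsMap p) m) := by
    intro y
    refine ⟨homologyMap (chainsMap (prodToPreimage P v)) m
      (homologyMap (chainsMap (sheetIncl P 0)) m y), ?_⟩
    rw [hp, ← homologyMap_chainsMap_comp]
    exact homologyMap_chainsMap_id m y
  have hbij := homologyMap_prodToPreimage_bijective (P := P) u v huv hvu n
  obtain ⟨e⟩ := nonempty_homology_equiv_of_cover (hU.preimage continuous_snd)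
    (hV.preimage continuous_snd) (by rw [← Set.preimage_union, hUV, Set.preimage_univ])
    (ContinuousMap.fst : C(P × Q, P)) (homologyMap_fst_restrict_bijective U)
    (homologyMap_fst_restrict_bijective V) hsurj n
  obtain ⟨e'⟩ := nonempty_ker_fst_equiv P k n
  let Φ : (homologyMap (chainsMap (ContinuousMap.fst : C(P × Fin (k + 1), P)))
      n).hom.toAddMonoidHom.ker →+ (homologyMap (chainsMap p) n).hom.toAddMonoidHom.ker :=
    { toFun x := ⟨homologyMap (chainsMap (prodToPreimage P v)) n x.1, (hp n x.1).trans x.2⟩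
      map_zero' := Subtype.ext (map_zero (homologyMap (chainsMap (prodToPreimage P v)) n).hom)
      map_add' x y := Subtype.ext
        (map_add (homologyMap (chainsMap (prodToPreimage P v)) n).hom x.1 y.1) }
  have hΦ : Function.Bijective Φ := by
    constructor
    · intro x y h
      exact Subtype.ext (hbij.1 (congrArg Subtype.val h))
    · rintro ⟨y, hy⟩
      obtain ⟨x, rfl⟩ := hbij.2 y
      exact ⟨⟨x, (hp n x).symm.trans hy⟩, rfl⟩
  exact ⟨e.trans ((AddEquiv.refl _).prodCongr ((AddEquiv.ofBijective Φ hΦ).symm.trans e'))⟩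

end OverBase

/-! ### Theta graphs: arc `j` is a parabola over coordinate axis `j`, and the arcs meet at heights 0
and 1 -/

/-- The theta graph, consisting of two poles joined by `k` arcs. -/
def Theta (k : ℕ) : Type :=
  {y : ℝ × (Fin k → ℝ) // y.1 ∈ Set.Icc 0 1 ∧ ∃ j, y.2 = Pi.single j (y.1 * (1 - y.1))}

namespace Theta

variable {k : ℕ}

instance : TopologicalSpace (Theta k) := inferInstanceAs (TopologicalSpace (Subtype _))

instance : T2Space (Theta k) := inferInstanceAs (T2Space (Subtype _))

/-- The height of a point of the theta graph. -/
def height (y : Theta k) : ℝ := y.1.1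

/-- The position of a point of the theta graph. -/
def pos (y : Theta k) : Fin k → ℝ := y.1.2

@[fun_prop]
theorem continuous_height : Continuous (height : Theta k → ℝ) :=
  continuous_fst.comp continuous_subtype_val

@[fun_prop]
theorem continuous_pos : Continuous (pos : Theta k → Fin k → ℝ) :=
  continuous_snd.comp continuous_subtype_val

theorem ext' {y z : Theta k} (h₁ : height y = height z) (h₂ : pos y = pos z) : y = z :=
  Subtype.ext (Prod.ext h₁ h₂)

theorem height_nonneg (y : Theta k) : 0 ≤ height y := y.2.1.1

theorem height_le_one (y : Theta k) : height y ≤ 1 := y.2.1.2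

theorem exists_pos_eq (y : Theta k) : ∃ j, pos y = Pi.single j (height y * (1 - height y)) := y.2.2

/-- The point at height `t` on the arc with index `j`. -/
def arc (j : Fin k) (t : unitInterval) : Theta k :=
  ⟨(t, Pi.single j (t * (1 - t))), t.2, j, rfl⟩

theorem pos_arc (j : Fin k) (t : unitInterval) :
    pos (arc j t) = Pi.single j ((t : ℝ) * (1 - t)) := rfl

theorem exists_eq_arc (y : Theta k) : ∃ j t, y = arc j t := by
  obtain ⟨j, hj⟩ := y.exists_pos_eq
  exact ⟨j, ⟨height y, y.2.1⟩, ext' rfl hj⟩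

@[fun_prop]
theorem continuous_arc (j : Fin k) : Continuous (arc j) := by
  refine Continuous.subtype_mk (Continuous.prodMk continuous_subtype_val ?_) _
  exact (continuous_single j).comp (by fun_prop)

/-- The reflection of the theta graph exchanging the poles. -/
def flip : Theta k ≃ₜ Theta k where
  toFun y := ⟨(1 - height y, pos y),
    ⟨by linarith [y.height_le_one], by linarith [y.height_nonneg]⟩,
    y.exists_pos_eq.imp fun j h => h.trans (by dsimp only; congr 1; ring)⟩
  invFun y := ⟨(1 - height y, pos y),
    ⟨by linarith [y.height_le_one], by linarith [y.height_nonneg]⟩,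
    y.exists_pos_eq.imp fun j h => h.trans (by dsimp only; congr 1; ring)⟩
  left_inv y := ext' (sub_sub_cancel 1 (height y)) rfl
  right_inv y := ext' (sub_sub_cancel 1 (height y)) rfl
  continuous_toFun := Continuous.subtype_mk (by fun_prop) _
  continuous_invFun := Continuous.subtype_mk (by fun_prop) _

/-- The theta graph without its upper pole. -/
def lower (k : ℕ) : Set (Theta k) := {y | height y < 1}

/-- The theta graph without its lower pole. -/
def upper (k : ℕ) : Set (Theta k) := {y | 0 < height y}

theorem isOpen_lower : IsOpen (lower k) := isOpen_lt continuous_height continuous_const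

theorem isOpen_upper : IsOpen (upper k) := isOpen_lt continuous_const continuous_height

theorem lower_union_upper : lower k ∪ upper k = Set.univ := by
  refine Set.eq_univ_of_forall fun y => ?_
  by_cases h : height y < 1
  · exact Or.inl h
  · exact Or.inr (lt_of_lt_of_le one_pos (not_lt.1 h))

/-- The contraction of the theta graph without its upper pole. -/
noncomputable def lowerContraction (s : unitInterval) (y : lower k) : lower k :=
  -- For height $h$, the factor turns $h(1-h)$ into $sh(1-sh)$, so the point stays on its arc; it is
  -- continuous since $h\ne1$.
  ⟨⟨(s * height y.1, (s * (1 - s * height y.1) / (1 - height y.1)) • pos y.1),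
    ⟨mul_nonneg s.2.1 y.1.height_nonneg, mul_le_one₀ s.2.2 y.1.height_nonneg y.1.height_le_one⟩, by
      obtain ⟨j, hj⟩ := y.1.exists_pos_eq
      refine ⟨j, ?_⟩
      have h : 1 - height y.1 ≠ 0 := (sub_pos.2 y.2).ne'
      dsimp only
      rw [hj, ← Pi.single_smul, smul_eq_mul]
      congr 1
      field_simp⟩,
    lt_of_le_of_lt (mul_le_of_le_one_left y.1.height_nonneg s.2.2) y.2⟩

theorem continuous_lowerContraction :
    Continuous fun z : unitInterval × lower k => lowerContraction z.1 z.2 := by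
  have h : Continuous fun z : unitInterval × lower k =>
      (z.1 : ℝ) * (1 - z.1 * height z.2.1) / (1 - height z.2.1) :=
    Continuous.div (by fun_prop) (by fun_prop) fun z => (sub_pos.2 z.2.2).ne'
  refine Continuous.subtype_mk (Continuous.subtype_mk (Continuous.prodMk (by fun_prop) ?_) _) _
  exact h.smul (continuous_pos.comp (continuous_subtype_val.comp continuous_snd))

/-- Scaling heights to zero slides every point to the lower pole. At least one arc is needed, as
`Theta 0` is empty. -/
instance contractibleSpace_lower : ContractibleSpace (lower (k + 1)) := by
  rw [contractible_iff_id_nullhomotopic]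
  refine ⟨⟨arc 0 0, (zero_lt_one : (0 : ℝ) < 1)⟩, ContinuousMap.Homotopic.symm ⟨{
    toFun z := lowerContraction z.1 z.2
    continuous_toFun := continuous_lowerContraction
    map_zero_left y := ?_
    map_one_left y := ?_ }⟩⟩
  · refine Subtype.ext (ext' ?_ ?_)
    · exact zero_mul _
    · exact (show ((0 : ℝ) * (1 - 0 * height y.1) / (1 - height y.1)) • pos y.1 =
        Pi.single 0 ((0 : ℝ) * (1 - 0)) by simp)
  · refine Subtype.ext (ext' ?_ ?_)
    · exact one_mul _
    · have h : 1 - height y.1 ≠ 0 := (sub_pos.2 y.2).ne'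
      exact (show ((1 : ℝ) * (1 - 1 * height y.1) / (1 - height y.1)) • pos y.1 = pos y.1 by
        rw [one_mul, one_mul, div_self h, one_smul])

/-- The reflection exchanges the upper and the lower part of the theta graph. -/
def upperHomeo : upper k ≃ₜ lower k :=
  flip.subtype fun y => (show 0 < height y ↔ 1 - height y < 1 by constructor <;> intro <;> linarith)

instance contractibleSpace_upper : ContractibleSpace (upper (k + 1)) :=
  upperHomeo.contractibleSpace

theorem exists_half_arc (k : ℕ) (j : Fin k) :
    arc j ⟨1 / 2, by norm_num, by norm_num⟩ ∈ lower k ∩ upper k :=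
  ⟨show (1 / 2 : ℝ) < 1 by norm_num, show (0 : ℝ) < 1 / 2 by norm_num⟩

instance : PathConnectedSpace (Theta (k + 1)) := by
  rw [pathConnectedSpace_iff_univ, ← lower_union_upper]
  exact (isPathConnected_iff_pathConnectedSpace.2 inferInstance).union
    (isPathConnected_iff_pathConnectedSpace.2 inferInstance) ⟨_, exists_half_arc (k + 1) 0⟩

/-- The middle points of the arcs. -/
noncomputable def middle (k : ℕ) : C(Fin k, (lower k ∩ upper k : Set (Theta k))) :=
  ⟨fun j => ⟨_, exists_half_arc k j⟩, continuous_of_discreteTopology⟩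

theorem prod_pos (y : (lower k ∩ upper k : Set (Theta k))) :
    0 < height y.1 * (1 - height y.1) :=
  mul_pos y.2.2 (sub_pos.2 y.2.1)

/-- The index of the arc containing a point that is not a pole. -/
noncomputable def arcIndex (y : (lower k ∩ upper k : Set (Theta k))) : Fin k :=
  y.1.exists_pos_eq.choose

theorem pos_eq_arcIndex (y : (lower k ∩ upper k : Set (Theta k))) :
    pos y.1 = Pi.single (arcIndex y) (height y.1 * (1 - height y.1)) :=
  y.1.exists_pos_eq.choose_spec

/-- Off the poles exactly one coordinate is positive, so the chosen index is unique. The condition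
on the right is open, which gives continuity of `arcIndex`. -/
theorem arcIndex_eq_iff (y : (lower k ∩ upper k : Set (Theta k))) (j : Fin k) :
    arcIndex y = j ↔ 0 < pos y.1 j := by
  rw [pos_eq_arcIndex]
  constructor
  · rintro rfl
    rw [Pi.single_eq_same]
    exact prod_pos y
  · intro h
    by_contra hne
    rw [Pi.single_eq_of_ne (Ne.symm hne)] at h
    exact h.false

theorem continuous_arcIndex :
    Continuous (arcIndex : (lower k ∩ upper k : Set (Theta k)) → Fin k) := by
  rw [continuous_discrete_rng]
  intro j
  have : arcIndex ⁻¹' {j} = {y : (lower k ∩ upper k : Set (Theta k)) | 0 < pos y.1 j} :=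
    Set.ext fun y => arcIndex_eq_iff y j
  rw [this]
  exact isOpen_lt continuous_const (by fun_prop)

theorem arcIndex_middle (j : Fin k) : arcIndex (middle k j) = j := by
  rw [arcIndex_eq_iff]
  change 0 < (Pi.single j (1 / 2 * (1 - 1 / 2)) : Fin k → ℝ) j
  rw [Pi.single_eq_same]
  norm_num

/-- The height moved towards one half. -/
noncomputable def midHeight (s : unitInterval) (y : Theta k) : ℝ := s * height y + (1 - s) / 2

theorem midHeight_mem (s : unitInterval) (y : (lower k ∩ upper k : Set (Theta k))) :
    midHeight s y.1 ∈ Set.Ioo (0 : ℝ) 1 := by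
  have h₀ := y.2.2
  have h₁ := y.2.1
  have hs₀ := s.2.1
  have hs₁ := s.2.2
  change 0 < height y.1 at h₀
  change height y.1 < 1 at h₁
  unfold midHeight
  constructor
  · rcases hs₀.eq_or_lt with h | h
    · rw [← h]; norm_num
    · have := mul_pos h h₀
      linarith
  · rcases hs₀.eq_or_lt with h | h
    · rw [← h]; norm_num
    · have := mul_lt_mul_of_pos_left h₁ h
      linarith

/-- The contraction of the open arcs to their middle points. -/
noncomputable def midContraction (s : unitInterval) (y : (lower k ∩ upper k : Set (Theta k))) :
    (lower k ∩ upper k : Set (Theta k)) :=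
  -- The scalar replaces $h(1-h)$ by the value at the new height, keeping the point on its arc.
  ⟨⟨(midHeight s y.1, (midHeight s y.1 * (1 - midHeight s y.1) /
      (height y.1 * (1 - height y.1))) • pos y.1), Set.Ioo_subset_Icc_self (midHeight_mem s y), by
      refine ⟨arcIndex y, ?_⟩
      dsimp only
      rw [pos_eq_arcIndex, ← Pi.single_smul, smul_eq_mul, div_mul_cancel₀ _ (prod_pos y).ne']⟩,
    (midHeight_mem s y).2, (midHeight_mem s y).1⟩

theorem continuous_midContraction : Continuous
    fun z : unitInterval × (lower k ∩ upper k : Set (Theta k)) => midContraction z.1 z.2 := by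
  have h : Continuous fun z : unitInterval × (lower k ∩ upper k : Set (Theta k)) =>
      midHeight z.1 z.2.1 := by
    unfold midHeight
    fun_prop
  have h' : Continuous fun z : unitInterval × (lower k ∩ upper k : Set (Theta k)) =>
      midHeight z.1 z.2.1 * (1 - midHeight z.1 z.2.1) / (height z.2.1 * (1 - height z.2.1)) :=
    Continuous.div (by fun_prop) (by fun_prop) fun z => (prod_pos z.2).ne'
  refine Continuous.subtype_mk (Continuous.subtype_mk (Continuous.prodMk h ?_) _) _
  exact h'.smul (continuous_pos.comp (continuous_subtype_val.comp continuous_snd))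

theorem middle_comp_arcIndex_homotopic :
    ((middle k).comp ⟨arcIndex, continuous_arcIndex⟩).Homotopic (.id _) := by
  refine ⟨{
    toFun z := midContraction z.1 z.2
    continuous_toFun := continuous_midContraction
    map_zero_left y := ?_
    map_one_left y := ?_ }⟩
  · have h : midHeight 0 y.1 = 1 / 2 := by simp [midHeight]
    refine Subtype.ext (ext' h ?_)
    change (midHeight 0 y.1 * (1 - midHeight 0 y.1) / (height y.1 * (1 - height y.1))) • pos y.1 =
      Pi.single (arcIndex y) (1 / 2 * (1 - 1 / 2))
    rw [h, pos_eq_arcIndex, ← Pi.single_smul, smul_eq_mul, div_mul_cancel₀ _ (prod_pos y).ne']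
  · have h : midHeight 1 y.1 = height y.1 := by simp [midHeight]
    refine Subtype.ext (ext' h ?_)
    change (midHeight 1 y.1 * (1 - midHeight 1 y.1) / (height y.1 * (1 - height y.1))) • pos y.1 =
      pos y.1
    rw [h, div_self (prod_pos y).ne', one_smul]

theorem nonempty_homology_prod_equiv (P : Type) [TopologicalSpace P] (k n : ℕ) :
    Nonempty ((chains (P × Theta (k + 1))).homology (n + 1) ≃+
      (chains P).homology (n + 1) × (Fin k → (chains P).homology n)) := by
  refine _root_.nonempty_homology_prod_equiv isOpen_lower isOpen_upper lower_union_upper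
    ⟨arcIndex, continuous_arcIndex⟩ (middle (k + 1)) ?_ middle_comp_arcIndex_homotopic n
  have : (ContinuousMap.mk arcIndex continuous_arcIndex).comp (middle (k + 1)) = .id _ :=
    ContinuousMap.ext arcIndex_middle
  rw [this]

end Theta

/-! ### Coincidences between arcs -/

namespace Theta

variable {k : ℕ}

theorem arc_zero (i j : Fin k) : arc i 0 = arc j 0 :=
  ext' rfl (by simp [pos_arc])

theorem arc_one (i j : Fin k) : arc i 1 = arc j 1 :=
  ext' rfl (by simp [pos_arc])

/-- Heights agree; if the arcs differ, comparing coordinate `i` forces $t(1-t)=0$. -/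
theorem eq_of_arc_eq_arc {i j : Fin k} {s t : I} (h : arc i s = arc j t) :
    s = t ∧ (i = j ∨ t = 0 ∨ t = 1) := by
  have hst : s = t := Subtype.ext (congrArg height h)
  subst hst
  refine ⟨rfl, ?_⟩
  by_contra! hne
  obtain ⟨hij, h₀, h₁⟩ := hne
  have hp := congrFun (congrArg pos h) i
  rw [pos_arc, pos_arc, Pi.single_eq_same, Pi.single_eq_of_ne hij, mul_eq_zero, sub_eq_zero] at hp
  rcases hp with hp | hp
  · exact h₀ (Subtype.ext hp)
  · exact h₁ (Subtype.ext hp.symm)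

end Theta

/-! ### The tile complex as a product of two theta graphs -/

namespace TileComplex

variable (α β : ℕ)

/-- The edges of the complete bipartite graph. -/
abbrev Edge : Type :=
  {e : Fin α × Fin β // (completeBipartiteGraph (Fin α) (Fin β)).Adj (Sum.inl e.1) (Sum.inr e.2)}

/-- The tile complex of the complete bipartite graph. -/
abbrev Complex : Type := TC (completeBipartiteGraph (Fin α) (Fin β))

variable {α β}

/-- The edge joining two vertices of different colours. -/
def edge (i : Fin α) (j : Fin β) : Edge α β := ⟨(i, j), by simp⟩

/-- The point with given coordinates in the tile of an edge. -/
def point (i : Fin α) (j : Fin β) (x y : I) : Complex α β := Quot.mk _ ⟨edge i j, (x, y)⟩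

theorem glue_point (a b : Edge α β) (k : Fin 4)
    (h : (tiles (completeBipartiteGraph (Fin α) (Fin β))).label a k =
      (tiles (completeBipartiteGraph (Fin α) (Fin β))).label b k) (s : I) :
    point a.1.1 a.1.2 (DirectedSquares.side k s).1 (DirectedSquares.side k s).2 =
      point b.1.1 b.1.2 (DirectedSquares.side k s).1 (DirectedSquares.side k s).2 :=
  Quot.sound (DirectedSquares.Glue.mk a b k k h s)

/-- Vertical sides carry the labels $v_j^1,v_j^2$, which do not involve $i$. Side `3` runs
downwards, hence the parameter `σ y`. -/
theorem point_left_congr (i i' : Fin α) (j : Fin β) {x : I} (hx : x = 0 ∨ x = 1) (y : I) :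
    point i j x y = point i' j x y := by
  rcases hx with rfl | rfl
  · have := glue_point (edge i j) (edge i' j) 3 rfl (σ y)
    simpa [DirectedSquares.side, edge] using this
  · exact glue_point (edge i j) (edge i' j) 1 rfl y

theorem point_right_congr (i : Fin α) (j j' : Fin β) (x : I) {y : I} (hy : y = 0 ∨ y = 1) :
    point i j x y = point i j' x y := by
  rcases hy with rfl | rfl
  · exact glue_point (edge i j) (edge i j') 0 rfl x
  · have := glue_point (edge i j) (edge i j') 2 rfl (σ x)
    simpa [DirectedSquares.side, edge] using this

/-- The map from the disjoint union of the tiles to the product of theta graphs. -/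
def tileMap (z : Σ _ : Edge α β, I × I) : Theta α × Theta β :=
  (Theta.arc z.1.1.1 z.2.1, Theta.arc z.1.1.2 z.2.2)

theorem tileMap_eq_of_glue (z z' : Σ _ : Edge α β, I × I)
    (h : (tiles (completeBipartiteGraph (Fin α) (Fin β))).Glue z z') : tileMap z = tileMap z' := by
  obtain ⟨⟨⟨i, j⟩, hij⟩, ⟨⟨i', j'⟩, hij'⟩, k, l, h, s⟩ := h
  -- Equal labels force `k = l`. The glued sides then share one arc, and in the other factor they
  -- sit at a pole, where all arcs meet.
  fin_cases k <;> fin_cases l <;>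
    simp [tiles, DirectedSquares.directedSide, DirectedSquares.side, tileMap] at h ⊢ <;>
    subst h <;> constructor <;>
    first | rfl | exact Theta.arc_zero _ _ | exact Theta.arc_one _ _

/-- The map from the tile complex to the product of theta graphs. -/
def toProd : Complex α β → Theta α × Theta β := Quot.lift tileMap tileMap_eq_of_glue

theorem continuous_toProd : Continuous (toProd : Complex α β → Theta α × Theta β) := by
  refine continuous_quot_lift _ (continuous_sigma fun e => ?_)
  exact ((Theta.continuous_arc e.1.1).comp continuous_fst).prodMk
    ((Theta.continuous_arc e.1.2).comp continuous_snd)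

theorem toProd_point (i : Fin α) (j : Fin β) (x y : I) :
    toProd (point i j x y) = (Theta.arc i x, Theta.arc j y) := rfl

theorem exists_eq_point (z : Complex α β) : ∃ i j x y, z = point i j x y := by
  obtain ⟨⟨⟨⟨i, j⟩, h⟩, x, y⟩, rfl⟩ := Quot.exists_rep z
  exact ⟨i, j, x, y, rfl⟩

/-- Arcs meet only at poles, that is, over sides of the squares, where the gluing allows the index
to be changed, one factor at a time. -/
theorem toProd_bijective : Function.Bijective (toProd : Complex α β → Theta α × Theta β) := by
  constructor
  · intro z z' h
    obtain ⟨i, j, x, y, rfl⟩ := exists_eq_point z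
    obtain ⟨i', j', x', y', rfl⟩ := exists_eq_point z'
    rw [toProd_point, toProd_point, Prod.mk.injEq] at h
    obtain ⟨rfl, hi⟩ := Theta.eq_of_arc_eq_arc h.1
    obtain ⟨rfl, hj⟩ := Theta.eq_of_arc_eq_arc h.2
    have h₁ : point i j x y = point i' j x y := by
      rcases hi with rfl | hx
      · rfl
      · exact point_left_congr i i' j hx y
    have h₂ : point i' j x y = point i' j' x y := by
      rcases hj with rfl | hy
      · rfl
      · exact point_right_congr i' j j' x hy
    exact h₁.trans h₂
  · rintro ⟨y, y'⟩
    obtain ⟨i, s, rfl⟩ := y.exists_eq_arc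
    obtain ⟨j, t, rfl⟩ := y'.exists_eq_arc
    exact ⟨point i j s t, rfl⟩

/-- The tile complex of a complete bipartite graph is a product of theta graphs. -/
noncomputable def homeo : Complex α β ≃ₜ Theta α × Theta β :=
  continuous_toProd.homeoOfEquivCompactToT2 (f := Equiv.ofBijective toProd toProd_bijective)

end TileComplex

/-! ### Homology of theta graphs and of the tile complex -/

section Homology

open HomologicalComplex

theorem nonempty_linearEquiv_of_addEquiv {M N : Type} [AddCommGroup M] [AddCommGroup N]
    [Module ℤ M] [Module ℤ N] (e : M ≃+ N) : Nonempty (M ≃ₗ[ℤ] N) :=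
  ⟨e.toLinearEquiv fun c x => by simpa using map_intCast_smul e ℤ ℤ c x⟩

/-- The additive group of singular homology. -/
noncomputable def integralHomologyEquiv (n : ℕ) (X : Type) [TopologicalSpace X] :
    integralHomology n X ≃+ (chains X).homology n :=
  (integralHomologyIso n X).toLinearEquiv.toAddEquiv

theorem nonempty_homology_equiv_of_homeomorph {X Y : Type} [TopologicalSpace X]
    [TopologicalSpace Y] (e : X ≃ₜ Y) (n : ℕ) :
    Nonempty ((chains X).homology n ≃+ (chains Y).homology n) := by
  refine ⟨AddEquiv.ofBijective (homologyMap (chainsMap (e : C(X, Y))) n).hom.toAddMonoidHom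
    (homologyMap_chainsMap_bijective (e : C(X, Y)) (e.symm : C(Y, X)) ?_ ?_ n)⟩
  · rw [Homeomorph.symm_comp_toContinuousMap]
  · rw [Homeomorph.toContinuousMap_comp_symm]

theorem nonempty_homology_zero_equiv (X : Type) [TopologicalSpace X] [PathConnectedSpace X] :
    Nonempty ((chains X).homology 0 ≃+ ℤ) := by
  have : IsIso ((TopCat.of X).singularHomology₀ε (ModuleCat.of ℤ ℤ)) :=
    haveI : PathConnectedSpace (TopCat.of X) := ‹_›
    inferInstance
  exact ⟨(integralHomologyEquiv 0 X).symm.trans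
    (asIso ((TopCat.of X).singularHomology₀ε (ModuleCat.of ℤ ℤ))).toLinearEquiv.toAddEquiv⟩

theorem subsingleton_homology_punit (n : ℕ) :
    Subsingleton ((chains PUnit.{1}).homology (n + 1)) := by
  have : TotallyDisconnectedSpace (TopCat.of PUnit.{1}) :=
    inferInstanceAs (TotallyDisconnectedSpace PUnit.{1})
  have h := isZero_singularHomologyFunctor_of_totallyDisconnectedSpace (ModuleCat.{0} ℤ) (n + 1)
    (ModuleCat.of ℤ ℤ) (TopCat.of PUnit.{1}) n.succ_ne_zero
  have := ModuleCat.subsingleton_of_isZero h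
  exact (integralHomologyEquiv (n + 1) PUnit.{1}).symm.injective.subsingleton

/-- A point of `X` gives a section, so the induced map is surjective. Both groups are $\mathbb{Z}$,
and a surjective endomorphism of $\mathbb{Z}$ is injective. -/
theorem reducedHomology_zero_eq_bot (X : Type) [TopologicalSpace X] [PathConnectedSpace X] :
    reducedHomology 0 X = ⊥ := by
  let F := (singularHomologyFunctor (ModuleCat.{0} ℤ) 0).obj (ModuleCat.of ℤ ℤ)
  let f : TopCat.of X ⟶ TopCat.of PUnit.{1} := TopCat.ofHom (ContinuousMap.const X PUnit.unit)
  let s : TopCat.of PUnit.{1} ⟶ TopCat.of X := TopCat.ofHom (.const _ (Classical.arbitrary X))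
  have hsf : F.map s ≫ F.map f = 𝟙 _ := (F.map_comp s f).symm.trans (F.map_id _)
  have hsurj : Function.Surjective (F.map f) := fun y => ⟨F.map s y, congr($(hsf).hom y)⟩
  obtain ⟨eX⟩ := nonempty_homology_zero_equiv X
  obtain ⟨eP⟩ := nonempty_homology_zero_equiv PUnit.{1}
  let eX' : F.obj (TopCat.of X) ≃+ ℤ := (integralHomologyEquiv 0 X).trans eX
  let eP' : F.obj (TopCat.of PUnit.{1}) ≃+ ℤ := (integralHomologyEquiv 0 PUnit.{1}).trans eP
  let g : ℤ →+ ℤ := (eP'.toAddMonoidHom.comp (F.map f).hom.toAddMonoidHom).comp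
    eX'.symm.toAddMonoidHom
  have hg : Function.Surjective g.toIntLinearMap :=
    eP'.surjective.comp (hsurj.comp eX'.symm.surjective)
  have hinj := OrzechProperty.injective_of_surjective_endomorphism _ hg
  refine LinearMap.ker_eq_bot.2 fun x y hxy => eX'.injective (hinj ?_)
  change eP' (F.map f (eX'.symm (eX' x))) = eP' (F.map f (eX'.symm (eX' y)))
  rw [eX'.symm_apply_apply, eX'.symm_apply_apply]
  exact congrArg eP' hxy

/-- The factor `PUnit` presents the theta graph itself as a product, so that the product formula
applies with $P$ a point. -/
theorem nonempty_homology_one_equiv (k : ℕ) :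
    Nonempty ((chains (PUnit.{1} × Theta (k + 1))).homology 1 ≃+ (Fin k → ℤ)) := by
  obtain ⟨e⟩ := Theta.nonempty_homology_prod_equiv PUnit.{1} k 0
  obtain ⟨e₀⟩ := nonempty_homology_zero_equiv PUnit.{1}
  have := subsingleton_homology_punit 0
  have : Unique ((chains PUnit.{1}).homology (0 + 1)) := uniqueOfSubsingleton 0
  exact ⟨e.trans (AddEquiv.uniqueProd.trans (AddEquiv.piCongrRight fun _ => e₀))⟩

theorem subsingleton_homology_theta (k n : ℕ) :
    Subsingleton ((chains (PUnit.{1} × Theta (k + 1))).homology (n + 2)) := by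
  obtain ⟨e⟩ := Theta.nonempty_homology_prod_equiv PUnit.{1} k (n + 1)
  have := subsingleton_homology_punit n
  have := subsingleton_homology_punit (n + 1)
  exact e.injective.subsingleton

theorem nonempty_integralHomology_equiv (a b n : ℕ) :
    Nonempty (integralHomology (n + 1) (TileComplex.Complex (a + 1) (b + 1)) ≃+
      (chains (PUnit.{1} × Theta (a + 1))).homology (n + 1) ×
        (Fin b → (chains (PUnit.{1} × Theta (a + 1))).homology n)) := by
  obtain ⟨e⟩ := Theta.nonempty_homology_prod_equiv (PUnit.{1} × Theta (a + 1)) b n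
  obtain ⟨e'⟩ := nonempty_homology_equiv_of_homeomorph (TileComplex.homeo.trans
    ((Homeomorph.punitProd (Theta (a + 1))).symm.prodCongr (.refl (Theta (b + 1))))) (n + 1)
  exact ⟨(integralHomologyEquiv _ _).trans (e'.trans e)⟩

end Homology

theorem mainTheorem3 (α β : ℕ) (hα : 2 ≤ α) (hβ : 2 ≤ β) :
    reducedHomology 0 (TC (completeBipartiteGraph (Fin α) (Fin β))) = ⊥ ∧
    Nonempty (integralHomology 0 (TC (completeBipartiteGraph (Fin α) (Fin β))) ≃ₗ[ℤ] ℤ) ∧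
    Nonempty (integralHomology 1 (TC (completeBipartiteGraph (Fin α) (Fin β))) ≃ₗ[ℤ]
      (Fin (α + β - 2) → ℤ)) ∧
    Nonempty (integralHomology 2 (TC (completeBipartiteGraph (Fin α) (Fin β))) ≃ₗ[ℤ]
      (Fin ((α - 1) * (β - 1)) → ℤ)) ∧
    ∀ n : ℕ, 3 ≤ n →
      Subsingleton (integralHomology n (TC (completeBipartiteGraph (Fin α) (Fin β)))) := by
  obtain ⟨a, rfl⟩ : ∃ a, α = a + 1 := ⟨α - 1, by lia⟩
  obtain ⟨b, rfl⟩ : ∃ b, β = b + 1 := ⟨β - 1, by lia⟩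
  have : PathConnectedSpace (TileComplex.Complex (a + 1) (b + 1)) :=
    TileComplex.homeo.symm.surjective.pathConnectedSpace TileComplex.homeo.symm.continuous
  obtain ⟨e₁⟩ := nonempty_homology_one_equiv a
  refine ⟨reducedHomology_zero_eq_bot _, ?_, ?_, ?_, ?_⟩
  · obtain ⟨e⟩ := nonempty_homology_zero_equiv (TileComplex.Complex (a + 1) (b + 1))
    exact nonempty_linearEquiv_of_addEquiv ((integralHomologyEquiv 0 _).trans e)
  -- $H_1(\Theta_\alpha)\oplus H_0(\Theta_\alpha)^b\cong\mathbb{Z}^a\oplus\mathbb{Z}^b$.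
  · obtain ⟨e⟩ := nonempty_integralHomology_equiv a b 0
    obtain ⟨e₀⟩ := nonempty_homology_zero_equiv (PUnit.{1} × Theta (a + 1))
    have hab : a + b = a + 1 + (b + 1) - 2 := by lia
    exact nonempty_linearEquiv_of_addEquiv (e.trans ((e₁.prodCongr
      (AddEquiv.piCongrRight fun _ => e₀)).trans
        ((LinearEquiv.sumArrowLequivProdArrow (Fin a) (Fin b) ℤ ℤ).symm.toAddEquiv.trans
          (LinearEquiv.funCongrLeft ℤ ℤ
            ((finSumFinEquiv.trans (finCongr hab)).symm)).toAddEquiv)))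
  -- $H_2(\Theta_\alpha)=0$, which leaves $H_1(\Theta_\alpha)^b\cong(\mathbb{Z}^a)^b$.
  · obtain ⟨e⟩ := nonempty_integralHomology_equiv a b 1
    have := subsingleton_homology_theta a 0
    have : Unique ((chains (PUnit.{1} × Theta (a + 1))).homology (1 + 1)) := uniqueOfSubsingleton 0
    exact nonempty_linearEquiv_of_addEquiv (e.trans (AddEquiv.uniqueProd.trans
      ((AddEquiv.piCongrRight fun _ => e₁).trans
        ((LinearEquiv.curry ℤ ℤ (Fin b) (Fin a)).symm.toAddEquiv.trans
          (LinearEquiv.funCongrLeft ℤ ℤ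
            (((Equiv.prodComm (Fin b) (Fin a)).trans finProdFinEquiv).symm)).toAddEquiv))))
  · intro n hn
    obtain ⟨m, rfl⟩ : ∃ m, n = m + 2 + 1 := ⟨n - 3, by lia⟩
    obtain ⟨e⟩ := nonempty_integralHomology_equiv a b (m + 2)
    have := subsingleton_homology_theta a m
    have := subsingleton_homology_theta a (m + 1)
    exact e.injective.subsingleton
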